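/- Consider data $c_I\in\mathbb R^{n_x}$, $c_C\in\mathbb R^{n_y}$, real matrices $F,G,A,B,U,V,W$ and vectors $f,g,d,w$ of compatible sizes, $\bar\xi\in\mathbb R^n$ and a real symmetric matrix $\Sigma\in\mathbb R^{n\times n}$. Let $X=\{x\in\{0,1\}^{n_x}: Fx\ge f\}$, and for $x\in X$, $\xi\in\mathbb R^n$ let $$Q(x,\xi)=\min_y\{c_C^\top y:\ Gy\ge g,\ Ax+By\ge d,\ Uy+V\xi=Ww\}.$$ Let $\mathcal P$ be the set of Borel probability measures $\mathbb P$ on $\Xi=\mathbb R^n$ with finite second moments, $\mathbb E_{\mathbb P}[\xi]=\bar\xi$ and $\mathbb E_{\mathbb P}[\xi\xi^\top]=\Theta:=\Sigma+\bar\xi\bar\xi^\top$. The two-stage distributionally robust unit commitment problem (DRUC) is $$\min_{x\in X}\ \max_{\mathbb P\in\mathcal P}\ c_I^\top x+\mathbb E_{\mathbb P}[Q(x,\xi)].$$ Let $\Omega=\{(\lambda,\mu,\nu): G^\top\lambda+B^\top\mu+U^\top\nu=c_C,\ \lambda\ge0,\ \mu\ge0\}$ be the feasible polyhedron of the dual of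 the second-stage linear program, and $\operatorname{vert}(\Omega)$ its set of vertices (extreme points). The mixed-integer semidefinite program (MI-SDP) is $$\min_{x,H,h,h_0}\ c_I^\top x+\operatorname{tr}(H^\top\Theta)+h^\top\bar\xi+h_0\quad\text{s.t. } x\in X,\quad M_v(x,H,h,h_0)\succeq0\ \ \forall v\in\operatorname{vert}(\Omega),$$ where, for $v=(\lambda,\mu,\nu)$, $$M_v(x,H,h,h_0)=\begin{bmatrix}H&\tfrac12(h+V^\top\nu)\\ \tfrac12(h+V^\top\nu)^\top& h_0-g^\top\lambda+(Ax-d)^\top\mu-(Ww)^\top\nu\end{bmatrix},$$ and $H$ is a symmetric $n\times n$ matrix. Assume that $\Sigma\succ0$, that the second-stage linear program is feasible for every $x\in X$ and every $\xi\in\mathbb R^n$, and that $\Omega$ has at least one vertex (equivalently, $\Omega\neq\emptyset$ and $U$ has full row rank; in particular the second-stage program is bounded). Then: 1. $\operatorname{vert}(\Omega)$ is finite, so the MI-SDP has finitely many constraints. 2. For every $x\in X$ and $\xi\in\mathbb R^n$ the minimum $Q(x,\xi)$ is attained, and $$Q(x,\xi)=\max_{(\lambda,\mu,\nu)\in\Omega}\ell(\lambda,\mu,\nu)=\max_{(\lambda,\mu,\nu)\in\operatorname{vert}(\Omega)}\ell(\lambda,\mu,\nu),\qquad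 \ell=g^\top\lambda-(Ax-d)^\top\mu-(V\xi-Ww)^\top\nu .$$ 3. For every $x\in X$, $Q(x,\cdot)$ is integrable under every $\mathbb P\in\mathcal P$, and strong duality holds for the moment problem, with both optima attained: $$\max_{\mathbb P\in\mathcal P}\mathbb E_{\mathbb P}[Q(x,\xi)]=\min_{H=H^\top,h,h_0}\{\operatorname{tr}(H^\top\Theta)+h^\top\bar\xi+h_0:\ \xi^\top H\xi+h^\top\xi+h_0\ge Q(x,\xi)\ \ \forall\xi\in\mathbb R^n\}.$$ 4. For every $x\in X$, symmetric $H$, $h\in\mathbb R^n$, $h_0\in\mathbb R$ and $v=(\lambda,\mu,\nu)\in\operatorname{vert}(\Omega)$: $\xi^\top H\xi+h^\top\xi+h_0\ge g^\top\lambda-(Ax-d)^\top\mu-(V\xi-Ww)^\top\nu$ for all $\xi\in\mathbb R^n$ if and only if $M_v(x,H,h,h_0)\succeq0$. Consequently the constraint in the minimum of part 3 holds if and only if $M_v(x,H,h,h_0)\succeq0$ for all $v\in\operatorname{vert}(\Omega)$. 5. (DRUC) and (MI-SDP) have the same optimal value (both $+\infty$ if $X=\emptyset$); $x$ is optimal for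 (DRUC) if and only if $(x,H,h,h_0)$ is optimal for (MI-SDP) for some $H,h,h_0$; and if $X\neq\emptyset$, optimal solutions exist. -/

import Mathlib

open Matrix MeasureTheory

noncomputable section

/-- The data of the compact two-stage unit commitment model under uncertainty:
cost vectors, constraint matrices and right-hand sides, and the mean `xbar` and
covariance matrix `Sigma` of the uncertain parameter `ξ ∈ ℝⁿ`. -/
structure UCData (nx ny n nw mF mG mA mU : ℕ) where
  cI : Fin nx → ℝ
  cC : Fin ny → ℝ
  F : Matrix (Fin mF) (Fin nx) ℝ
  f : Fin mF → ℝ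
  G : Matrix (Fin mG) (Fin ny) ℝ
  g : Fin mG → ℝ
  A : Matrix (Fin mA) (Fin nx) ℝ
  B : Matrix (Fin mA) (Fin ny) ℝ
  d : Fin mA → ℝ
  U : Matrix (Fin mU) (Fin ny) ℝ
  V : Matrix (Fin mU) (Fin n) ℝ
  W : Matrix (Fin mU) (Fin nw) ℝ
  w : Fin nw → ℝ
  xbar : Fin n → ℝ
  Sigma : Matrix (Fin n) (Fin n) ℝ

namespace UCData

variable {nx ny n nw mF mG mA mU : ℕ} (D : UCData nx ny n nw mF mG mA mU)

/-- First-stage feasible set: binary vectors `x` with `F x ≥ f`. -/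
def firstStage : Set (Fin nx → ℝ) :=
  {x | (∀ j, x j = 0 ∨ x j = 1) ∧ D.f ≤ D.F *ᵥ x}

/-- Feasible dispatch decisions `y` of the second stage, given `x` and `ξ`. -/
def dispatchSet (x : Fin nx → ℝ) (ξ : Fin n → ℝ) : Set (Fin ny → ℝ) :=
  {y | D.g ≤ D.G *ᵥ y ∧ D.d ≤ D.A *ᵥ x + D.B *ᵥ y ∧ D.U *ᵥ y + D.V *ᵥ ξ = D.W *ᵥ D.w}

/-- The attainable second-stage costs `c_Cᵀ y`. -/
def dispatchCosts (x : Fin nx → ℝ) (ξ : Fin n → ℝ) : Set ℝ :=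
  {c | ∃ y ∈ D.dispatchSet x ξ, c = D.cC ⬝ᵥ y}

/-- The second-stage value function `Q(x, ξ)`. -/
def Q (x : Fin nx → ℝ) (ξ : Fin n → ℝ) : ℝ := sInf (D.dispatchCosts x ξ)

/-- The ambiguity set: Borel probability measures on `ℝⁿ` with mean `xbar` and
second moment matrix `Sigma + xbar xbarᵀ` (all these moments being finite). -/
def ambiguitySet : Set (Measure (Fin n → ℝ)) :=
  {P | IsProbabilityMeasure P ∧
    (∀ i, Integrable (fun ξ : Fin n → ℝ => ξ i) P ∧ ∫ ξ, ξ i ∂P = D.xbar i) ∧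
    (∀ j k, Integrable (fun ξ : Fin n → ℝ => ξ j * ξ k) P ∧
      ∫ ξ, ξ j * ξ k ∂P = D.Sigma j k + D.xbar j * D.xbar k)}

/-- The attainable expected second-stage costs `E_P[Q(x, ξ)]` over the ambiguity set. -/
def expectedCosts (x : Fin nx → ℝ) : Set ℝ :=
  {c | ∃ P ∈ D.ambiguitySet, c = ∫ ξ, D.Q x ξ ∂P}

/-- The objective of the distributionally robust problem at the first-stage decision `x`:
`sup_P  c_Iᵀ x + E_P[Q(x, ξ)]`. -/
def drucObj (x : Fin nx → ℝ) : EReal :=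
  ⨆ P ∈ D.ambiguitySet, ((D.cI ⬝ᵥ x + ∫ ξ, D.Q x ξ ∂P : ℝ) : EReal)

/-- The optimal value of the distributionally robust problem (`⊤` if it is infeasible). -/
def drucValue : EReal := ⨅ x ∈ D.firstStage, D.drucObj x

/-- `x` is an optimal first-stage decision of the distributionally robust problem. -/
def IsDRUCOptimal (x : Fin nx → ℝ) : Prop :=
  x ∈ D.firstStage ∧ ∀ x' ∈ D.firstStage, D.drucObj x ≤ D.drucObj x'

/-- The feasible polyhedron `Ω` of the dual of the second-stage linear program,
in the variables `(lam, mu, nu)`. -/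
def Omega : Set ((Fin mG → ℝ) × (Fin mA → ℝ) × (Fin mU → ℝ)) :=
  {v | D.cC - (D.Gᵀ *ᵥ v.1 + D.Bᵀ *ᵥ v.2.1 + D.Uᵀ *ᵥ v.2.2) = 0 ∧ 0 ≤ v.1 ∧ 0 ≤ v.2.1}

/-- The vertices (extreme points) of `Ω`. -/
def vert : Set ((Fin mG → ℝ) × (Fin mA → ℝ) × (Fin mU → ℝ)) :=
  Set.extremePoints ℝ D.Omega

/-- The objective `gᵀ lam - (A x - d)ᵀ mu - (V ξ - W w)ᵀ nu` of the second-stage dual. -/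
def dualObj (x : Fin nx → ℝ) (ξ : Fin n → ℝ)
    (v : (Fin mG → ℝ) × (Fin mA → ℝ) × (Fin mU → ℝ)) : ℝ :=
  D.g ⬝ᵥ v.1 - (D.A *ᵥ x - D.d) ⬝ᵥ v.2.1 - (D.V *ᵥ ξ - D.W *ᵥ D.w) ⬝ᵥ v.2.2

/-- `Θ = Sigma + xbar xbarᵀ`. -/
def Theta : Matrix (Fin n) (Fin n) ℝ := D.Sigma + vecMulVec D.xbar D.xbar

/-- The quadratic function `ξᵀ H ξ + hᵀ ξ + h₀`. -/
def quadFun (H : Matrix (Fin n) (Fin n) ℝ) (h : Fin n → ℝ) (h0 : ℝ) (ξ : Fin n → ℝ) : ℝ :=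
  ξ ⬝ᵥ (H *ᵥ ξ) + h ⬝ᵥ ξ + h0

/-- The moment objective `tr(Hᵀ Θ) + hᵀ xbar + h₀`. -/
def momentObj (H : Matrix (Fin n) (Fin n) ℝ) (h : Fin n → ℝ) (h0 : ℝ) : ℝ :=
  (Hᵀ * D.Theta).trace + h ⬝ᵥ D.xbar + h0

/-- Feasibility for the semi-infinite dual of the moment problem: `H` is symmetric and the
quadratic function dominates `Q(x, ·)` on all of `ℝⁿ`. -/
def SemiInfFeasible (x : Fin nx → ℝ) (H : Matrix (Fin n) (Fin n) ℝ) (h : Fin n → ℝ)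
    (h0 : ℝ) : Prop :=
  H.IsSymm ∧ ∀ ξ, D.Q x ξ ≤ quadFun H h h0 ξ

/-- The attainable objective values of the semi-infinite dual. -/
def semiInfCosts (x : Fin nx → ℝ) : Set ℝ :=
  {c | ∃ H h h0, D.SemiInfFeasible x H h h0 ∧ c = D.momentObj H h h0}

/-- The bordered matrix of the linear matrix inequality attached to `v = (lam, mu, nu)`. -/
def borderedMatrix (x : Fin nx → ℝ) (H : Matrix (Fin n) (Fin n) ℝ) (h : Fin n → ℝ) (h0 : ℝ)
    (v : (Fin mG → ℝ) × (Fin mA → ℝ) × (Fin mU → ℝ)) : Matrix (Fin n ⊕ Unit) (Fin n ⊕ Unit) ℝ :=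
  fromBlocks H
    (replicateCol Unit ((1 / 2 : ℝ) • (h + D.Vᵀ *ᵥ v.2.2)))
    (replicateRow Unit ((1 / 2 : ℝ) • (h + D.Vᵀ *ᵥ v.2.2)))
    (of fun _ _ => h0 - D.g ⬝ᵥ v.1 + (D.A *ᵥ x - D.d) ⬝ᵥ v.2.1 - (D.W *ᵥ D.w) ⬝ᵥ v.2.2)

/-- Feasibility for the mixed-integer semidefinite program. -/
def MISDPFeasible (x : Fin nx → ℝ) (H : Matrix (Fin n) (Fin n) ℝ) (h : Fin n → ℝ)
    (h0 : ℝ) : Prop :=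
  x ∈ D.firstStage ∧ ∀ v ∈ D.vert, (D.borderedMatrix x H h h0 v).PosSemidef

/-- The objective of the mixed-integer semidefinite program. -/
def misdpObj (x : Fin nx → ℝ) (H : Matrix (Fin n) (Fin n) ℝ) (h : Fin n → ℝ) (h0 : ℝ) : ℝ :=
  D.cI ⬝ᵥ x + D.momentObj H h h0

/-- The optimal value of the mixed-integer semidefinite program (`⊤` if it is infeasible). -/
def misdpValue : EReal :=
  ⨅ (x : Fin nx → ℝ) (H : Matrix (Fin n) (Fin n) ℝ) (h : Fin n → ℝ) (h0 : ℝ)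
    (_ : D.MISDPFeasible x H h h0), ((D.misdpObj x H h h0 : ℝ) : EReal)

/-- `(x, H, h, h₀)` is an optimal solution of the mixed-integer semidefinite program. -/
def IsMISDPOptimal (x : Fin nx → ℝ) (H : Matrix (Fin n) (Fin n) ℝ) (h : Fin n → ℝ)
    (h0 : ℝ) : Prop :=
  D.MISDPFeasible x H h h0 ∧
    ∀ x' H' h' h0', D.MISDPFeasible x' H' h' h0' → D.misdpObj x H h h0 ≤ D.misdpObj x' H' h' h0'

end UCData

end

/-!
For a fixed first-stage decision, the second-stage dual has a feasible polyhedron `Ω` that does not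
depend on `ξ`. A vertex is determined by its active constraints, so there are finitely many
(`finite_extremePoints_polyhedron`), and a linear functional bounded on a polyhedron with a vertex
attains its maximum at one (`exists_extremePoint_ge`). With Farkas' lemma (`farkas_finset`) this
gives linear programming duality, and `Q(x, ·)` is a maximum of finitely many affine functions
`a v + b v ⬝ᵥ ξ`, one for each vertex `v` (`UCData.isLeast_Q_and_isGreatest_Q`).

The moment problem for such a maximum is a semidefinite program: the matrix of moments
`M = [Θ, ξ̄; ξ̄ᵀ, 1]` is split into positive semidefinite parts `[S v, m v; (m v)ᵀ, p v]`, one for each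
affine piece, so as to maximize `∑ v, (a v * p v + b v ⬝ᵥ m v)`. The set of splittings is compact,
so there is an optimal one.
* It yields a law (`exists_measure_of_masses`): mass `p v` at `m v / p v`, convolved with centred
  noise whose covariance is the missing part of the second moments. A maximum of affine functions is
  convex, so the noise does not decrease its expectation, which is thus at least the optimal value.
* Since `Σ` is positive definite, `M` is an order unit of the positive semidefinite cone, and the
  M. Riesz extension theorem gives a linear functional on matrices that dominates the objective of
  every piece and equals the optimal value at `M` (`exists_linear_majorant`). On the matrices of
  moments of point masses it is a quadratic function that dominates `Q(x, ·)`.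

As the expectation of a quadratic function under any admissible law is its moment objective, both are
optimal and there is no gap. Finally a quadratic function is nonnegative iff its bordered matrix is
positive semidefinite (`quadratic_nonneg_iff_bordered_posSemidef`), which turns the semi-infinite
dual into the semidefinite program over the vertices; the first-stage decisions are finitely many.
-/

/-! ### Farkas' lemma -/

/-- **Farkas' lemma** for finitely many linear functionals on an arbitrary real vector space.
In the inductive step a point `x₀` violating the conclusion for the smaller family is used to
project along `x₀` onto the kernel of the new functional. -/
theorem farkas_finset {ι V : Type*} [AddCommGroup V] [Module ℝ V] (s : Finset ι)
    (a : ι → V →ₗ[ℝ] ℝ) (b : V →ₗ[ℝ] ℝ)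
    (hb : ∀ x, (∀ i ∈ s, 0 ≤ a i x) → 0 ≤ b x) :
    ∃ c : ι → ℝ, (∀ i, 0 ≤ c i) ∧ b = ∑ i ∈ s, c i • a i := by
  classical
  induction s using Finset.induction_on generalizing a b with
  | empty =>
    refine ⟨0, fun _ => le_rfl, ?_⟩
    ext x
    have h1 := hb x (by simp)
    have h2 := hb (-x) (by simp)
    rw [map_neg] at h2
    simpa using le_antisymm (by linarith) h1
  | insert k s hk ih =>
    by_cases h : ∀ x, (∀ i ∈ s, 0 ≤ a i x) → 0 ≤ b x
    · obtain ⟨c, hc, hbc⟩ := ih a b h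
      refine ⟨Function.update c k 0, fun i => ?_, ?_⟩
      · by_cases hi : i = k
        · simp [hi]
        · simpa [hi] using hc i
      · rw [Finset.sum_insert hk, hbc]
        simp only [Function.update_self, zero_smul, zero_add]
        refine Finset.sum_congr rfl fun i hi => ?_
        rw [Function.update_of_ne (by rintro rfl; exact hk hi)]
    · push Not at h
      obtain ⟨x, hx, hbx⟩ := h
      have hkx : a k x < 0 := by
        by_contra hcon
        refine absurd (hb x fun i hi => ?_) (not_le.mpr hbx)
        rcases Finset.mem_insert.mp hi with rfl | hi
        · exact not_lt.mp hcon
        · exact hx i hi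
      set y : V := (-(a k x))⁻¹ • x with hy
      have hpos : 0 < (-(a k x))⁻¹ := inv_pos.mpr (by linarith)
      have hky : a k y = -1 := by
        rw [hy, map_smul, smul_eq_mul]
        field_simp
        rw [div_self (by linarith [hkx] : a k x ≠ 0)]
      have hay : ∀ i ∈ s, 0 ≤ a i y := fun i hi => by
        rw [hy, map_smul, smul_eq_mul]
        exact mul_nonneg hpos.le (hx i hi)
      have hby : b y < 0 := by
        rw [hy, map_smul, smul_eq_mul]
        exact mul_neg_of_pos_of_neg hpos hbx
      obtain ⟨c, hc, hbc⟩ := ih (fun i => a i + a i y • a k) (b + b y • a k) (by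
        intro z hz
        have := hb (z + a k z • y) (by
          intro i hi
          rcases Finset.mem_insert.mp hi with rfl | hi
          · simp [hky]
          · have := hz i hi
            simp only [LinearMap.add_apply, LinearMap.smul_apply, smul_eq_mul] at this
            simp only [map_add, map_smul, smul_eq_mul]
            linarith)
        simp only [map_add, map_smul, smul_eq_mul] at this
        simp only [LinearMap.add_apply, LinearMap.smul_apply, smul_eq_mul]
        linarith)
      have hsum : 0 ≤ ∑ i ∈ s, c i * a i y :=
        Finset.sum_nonneg fun i hi => mul_nonneg (hc i) (hay i hi)
      refine ⟨Function.update c k (∑ i ∈ s, c i * a i y - b y), fun i => ?_, ?_⟩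
      · by_cases hi : i = k
        · subst hi
          simp only [Function.update_self]
          linarith
        · simpa [hi] using hc i
      · rw [Finset.sum_insert hk, Function.update_self]
        have h2 : ∑ i ∈ s, Function.update c k (∑ i ∈ s, c i * a i y - b y) i • a i
            = ∑ i ∈ s, c i • a i :=
          Finset.sum_congr rfl fun i hi => by
            rw [Function.update_of_ne (by rintro rfl; exact hk hi)]
        rw [h2]
        simp only [smul_add, Finset.sum_add_distrib, smul_smul, ← Finset.sum_smul] at hbc
        refine (eq_sub_of_add_eq hbc).trans ?_
        module

/-- A theorem of the alternative: an inconsistent system `k ≤ K y` has a Farkas certificate. -/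
theorem exists_farkas_certificate {ι κ : Type*} [Fintype ι] [Fintype κ]
    (K : Matrix ι κ ℝ) (k : ι → ℝ) (h : ¬ ∃ y : κ → ℝ, k ≤ K *ᵥ y) :
    ∃ c : ι → ℝ, 0 ≤ c ∧ c ᵥ* K = 0 ∧ 0 < c ⬝ᵥ k := by
  classical
  -- The system is homogenized with a variable `s ≥ 0`; inconsistency says that `s ≤ 0` follows.
  let p : ι → ((κ → ℝ) × ℝ) →ₗ[ℝ] ℝ := fun i =>
    (LinearMap.proj i ∘ₗ K.mulVecLin) ∘ₗ LinearMap.fst ℝ _ _ - k i • LinearMap.snd ℝ _ _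
  let a : Option ι → ((κ → ℝ) × ℝ) →ₗ[ℝ] ℝ := fun o => o.elim (LinearMap.snd ℝ _ _) p
  obtain ⟨c, hc, hbc⟩ := farkas_finset Finset.univ a (-LinearMap.snd ℝ _ _) (by
    rintro ⟨y, s⟩ hx
    have hs : 0 ≤ s := by simpa [a] using hx none (Finset.mem_univ _)
    by_contra hcon
    have hs' : 0 < s := by
      simp only [LinearMap.neg_apply, LinearMap.snd_apply] at hcon
      linarith
    refine h ⟨s⁻¹ • y, fun i => ?_⟩
    have h1 : k i * s ≤ (K *ᵥ y) i := by
      simpa [a, p] using hx (some i) (Finset.mem_univ _)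
    rw [mulVec_smul, Pi.smul_apply, smul_eq_mul, inv_mul_eq_div, le_div_iff₀ hs']
    exact h1)
  refine ⟨fun i => c (some i), fun i => hc _, ?_, ?_⟩
  · refine dotProduct_eq _ _ fun y => ?_
    have := LinearMap.congr_fun hbc (y, 0)
    rw [← dotProduct_mulVec, zero_dotProduct]
    simpa [a, p, Fintype.sum_option, dotProduct, LinearMap.sum_apply] using this.symm
  · have := LinearMap.congr_fun hbc (0, 1)
    simp [a, p, Fintype.sum_option, LinearMap.sum_apply] at this
    have h0 := hc none
    simp only [dotProduct]
    linarith

/-! ### Vertices of polyhedra -/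

section Polyhedron

variable {E F ι : Type*} [AddCommGroup E] [Module ℝ E] [AddCommGroup F] [Module ℝ F]

/-- The polyhedron `{v | L v = c, φ i v ≥ 0 for all i}`. -/
def polyhedron (L : E →ₗ[ℝ] F) (c : F) (φ : ι → E →ₗ[ℝ] ℝ) : Set E :=
  {v | L v = c ∧ ∀ i, 0 ≤ φ i v}

variable {L : E →ₗ[ℝ] F} {c : F} {φ : ι → E →ₗ[ℝ] ℝ}

/-- A point of a polyhedron is a vertex iff the constraints active there determine it. -/
theorem mem_extremePoints_polyhedron_iff [Finite ι] {v : E} (hv : v ∈ polyhedron L c φ) :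
    v ∈ (polyhedron L c φ).extremePoints ℝ ↔
      ∀ u, L u = 0 → (∀ i, φ i v = 0 → φ i u = 0) → u = 0 := by
  rw [mem_extremePoints]
  constructor
  · rintro ⟨-, hext⟩ u hLu hu
    have hev : ∀ᶠ t : ℝ in nhdsWithin 0 (Set.Ioi 0),
        0 < t ∧ ∀ i, 0 ≤ φ i v + t * φ i u ∧ 0 ≤ φ i v - t * φ i u := by
      refine Filter.Eventually.and self_mem_nhdsWithin (Filter.eventually_all.mpr fun i => ?_)
      rcases (hv.2 i).eq_or_lt with h0 | h0
      · exact Filter.Eventually.of_forall fun t => by rw [hu i h0.symm, ← h0]; simp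
      · have h1 : ∀ᶠ t : ℝ in nhds 0, 0 < φ i v + t * φ i u :=
          (by fun_prop : Continuous fun t : ℝ => φ i v + t * φ i u).continuousAt.eventually_const_lt
            (by simpa using h0)
        have h2 : ∀ᶠ t : ℝ in nhds 0, 0 < φ i v - t * φ i u :=
          (by fun_prop : Continuous fun t : ℝ => φ i v - t * φ i u).continuousAt.eventually_const_lt
            (by simpa using h0)
        filter_upwards [nhdsWithin_le_nhds h1, nhdsWithin_le_nhds h2] with t h3 h4
        exact ⟨h3.le, h4.le⟩
    obtain ⟨t, ht, hti⟩ := hev.exists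
    have := (hext (v + t • u) ⟨by simp [hLu, hv.1], fun i => by simpa using (hti i).1⟩
      (v - t • u) ⟨by simp [hLu, hv.1], fun i => by simpa using (hti i).2⟩
      ⟨1 / 2, 1 / 2, by norm_num, by norm_num, by norm_num, by module⟩).1
    have h5 : t • u = 0 := by simpa using this
    exact (smul_eq_zero.mp h5).resolve_left ht.ne'
  · intro h
    have key : ∀ x₁ ∈ polyhedron L c φ, ∀ x₂ ∈ polyhedron L c φ,
        v ∈ openSegment ℝ x₁ x₂ → x₁ = v := by
      rintro x₁ h₁ x₂ h₂ ⟨α, β, hα, hβ, -, rfl⟩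
      refine sub_eq_zero.mp (h _ (by rw [map_sub, h₁.1, hv.1, sub_self]) fun i hi => ?_)
      have e := hi
      rw [map_add, map_smul, map_smul, smul_eq_mul, smul_eq_mul] at e
      have h3 : α * φ i x₁ = 0 := by
        nlinarith [mul_nonneg hα.le (h₁.2 i), mul_nonneg hβ.le (h₂.2 i)]
      rw [map_sub, hi, (mul_eq_zero.mp h3).resolve_left hα.ne', sub_zero]
    exact ⟨hv, fun x₁ h₁ x₂ h₂ hs =>
      ⟨key x₁ h₁ x₂ h₂ hs, key x₂ h₂ x₁ h₁ (by rwa [openSegment_symm])⟩⟩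

/-- A polyhedron has finitely many vertices: a vertex is determined by its active set. -/
theorem finite_extremePoints_polyhedron [Finite ι] :
    ((polyhedron L c φ).extremePoints ℝ).Finite := by
  refine Set.Finite.of_finite_image (Set.toFinite ((fun v => {i | φ i v = 0}) '' _)) ?_
  intro v hv v' hv' hvv'
  have hP := extremePoints_subset hv
  have hP' := extremePoints_subset hv'
  refine (sub_eq_zero.mp ((mem_extremePoints_polyhedron_iff hP).mp hv (v' - v) ?_ ?_)).symm
  · rw [map_sub, hP.1, hP'.1, sub_self]
  · intro i hi
    have h : φ i v' = 0 := (Set.ext_iff.mp hvv' i).mp hi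
    rw [map_sub, hi, h, sub_zero]

/-- On a polyhedron with a vertex, a linear functional that is bounded above is dominated at each
point by its value at some vertex. From a point that is not a vertex, one moves along a direction
fixing the active constraints, on which the functional does not decrease, until a further
constraint becomes active. -/
theorem exists_extremePoint_ge [Finite ι]
    (hne : ((polyhedron L c φ).extremePoints ℝ).Nonempty) (ℓ : E →ₗ[ℝ] ℝ)
    (hbdd : BddAbove (ℓ '' polyhedron L c φ)) {v : E} (hv : v ∈ polyhedron L c φ) :
    ∃ v' ∈ (polyhedron L c φ).extremePoints ℝ, ℓ v ≤ ℓ v' := by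
  classical
  have := Fintype.ofFinite ι
  obtain ⟨v₀, hv₀⟩ := hne
  obtain ⟨C, hC⟩ := hbdd
  induction hn : (Finset.univ.filter fun i => φ i v ≠ 0).card using Nat.strong_induction_on
    generalizing v with
  | _ N ih =>
  by_cases hext : v ∈ (polyhedron L c φ).extremePoints ℝ
  · exact ⟨v, hext, le_rfl⟩
  rw [mem_extremePoints_polyhedron_iff hv] at hext
  push Not at hext
  obtain ⟨u₀, hL₀, hu₀, hne₀⟩ := hext
  obtain ⟨u, hLu, hu, hℓu, j, hj⟩ : ∃ u, L u = 0 ∧ (∀ i, φ i v = 0 → φ i u = 0) ∧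
      0 ≤ ℓ u ∧ ∃ j, φ j u < 0 := by
    have hpos : ∀ u, L u = 0 → 0 < ℓ u → ∃ j, φ j u < 0 := by
      intro u hL hℓ
      by_contra hcon
      push Not at hcon
      -- otherwise the ray from `v` in direction `u` stays in the polyhedron
      have hmem : v + ((C - ℓ v) / ℓ u + 1) • u ∈ polyhedron L c φ := by
        refine ⟨by simp [hL, hv.1], fun i => ?_⟩
        have h1 : 0 ≤ (C - ℓ v) / ℓ u :=
          div_nonneg (sub_nonneg.mpr (hC ⟨v, hv, rfl⟩)) hℓ.le
        rw [map_add, map_smul, smul_eq_mul]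
        exact add_nonneg (hv.2 i) (mul_nonneg (by linarith) (hcon i))
      have h2 := hC ⟨_, hmem, rfl⟩
      rw [map_add, map_smul, smul_eq_mul, add_mul, div_mul_cancel₀ _ hℓ.ne'] at h2
      linarith
    rcases lt_trichotomy (ℓ u₀) 0 with h | h | h
    · refine ⟨-u₀, by simp [hL₀], fun i hi => by simp [hu₀ i hi], by simpa using h.le,
        hpos _ (by simp [hL₀]) (by simpa using h)⟩
    · -- the vertex `v₀` excludes lines, so some constraint is not constant along `u₀`
      obtain ⟨j, hj⟩ : ∃ j, φ j u₀ ≠ 0 := by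
        by_contra hcon
        push Not at hcon
        exact hne₀ ((mem_extremePoints_polyhedron_iff (extremePoints_subset hv₀)).mp hv₀ u₀ hL₀
          fun i _ => hcon i)
      rcases hj.lt_or_gt with hj | hj
      · exact ⟨u₀, hL₀, hu₀, h.ge, j, hj⟩
      · exact ⟨-u₀, by simp [hL₀], fun i hi => by simp [hu₀ i hi], by simp [h], j, by simpa using hj⟩
    · exact ⟨u₀, hL₀, hu₀, h.le, hpos _ hL₀ h⟩
  obtain ⟨k, hk, hmin⟩ := Finset.exists_min_image (Finset.univ.filter fun i => φ i u < 0)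
    (fun i => φ i v / -φ i u) ⟨j, by simpa using hj⟩
  have hk' : φ k u < 0 := by simpa using hk
  set t := φ k v / -φ k u with ht
  have ht0 : 0 ≤ t := div_nonneg (hv.2 k) (by linarith)
  have hmem : v + t • u ∈ polyhedron L c φ := by
    refine ⟨by simp [hLu, hv.1], fun i => ?_⟩
    rw [map_add, map_smul, smul_eq_mul]
    by_cases hi : φ i u < 0
    · have h1 := hmin i (by simpa using hi)
      rw [le_div_iff₀ (by linarith)] at h1
      linarith
    · exact add_nonneg (hv.2 i) (mul_nonneg ht0 (not_lt.mp hi))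
  have hk0 : φ k (v + t • u) = 0 := by
    rw [map_add, map_smul, smul_eq_mul, ht, div_neg, neg_mul, div_mul_cancel₀ _ hk'.ne,
      add_neg_cancel]
  have hkv : φ k v ≠ 0 := fun h => hk'.ne (hu k h)
  have hlt : (Finset.univ.filter fun i => φ i (v + t • u) ≠ 0).card < N := by
    rw [← hn]
    refine Finset.card_lt_card ⟨fun i => ?_, fun hsub => ?_⟩
    · simp only [Finset.mem_filter, Finset.mem_univ, true_and]
      intro hi h
      exact hi (by rw [map_add, map_smul, h, hu i h, smul_zero, add_zero])
    · have := hsub (by simpa using hkv : k ∈ _)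
      exact (Finset.mem_filter.mp this).2 hk0
  obtain ⟨v', hv', hle⟩ := ih _ hlt hmem rfl
  refine ⟨v', hv', le_trans ?_ hle⟩
  rw [map_add, map_smul, smul_eq_mul]
  linarith [mul_nonneg ht0 hℓu]

end Polyhedron

/-! ### Conic duality over the positive semidefinite cone -/

/-- Nonnegativity of the quadratic form of a positive semidefinite real matrix. -/
theorem Matrix.PosSemidef.quadratic_nonneg {J : Type*} [Fintype J] {X : Matrix J J ℝ}
    (hX : X.PosSemidef) (x : J → ℝ) : 0 ≤ x ⬝ᵥ (X *ᵥ x) := by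
  simpa using hX.dotProduct_mulVec_nonneg x

/-- A real matrix is positive semidefinite iff it is symmetric with nonnegative quadratic form. -/
theorem Matrix.posSemidef_iff_real {J : Type*} [Fintype J] {X : Matrix J J ℝ} :
    X.PosSemidef ↔ X.IsSymm ∧ ∀ x, 0 ≤ x ⬝ᵥ (X *ᵥ x) := by
  rw [posSemidef_iff_dotProduct_mulVec]
  simp [IsHermitian, IsSymm, conjTranspose_eq_transpose_of_trivial]

/-- The feasible set of the semidefinite program whose variables are positive semidefinite
matrices `X i` with prescribed sum `M`. -/
def psdDecompositions {J : Type*} (ι : Type*) [Fintype ι] (M : Matrix J J ℝ) :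
    Set (ι → Matrix J J ℝ) :=
  {X | (∀ i, (X i).PosSemidef) ∧ ∑ i, X i = M}

theorem psdDecompositions_nonempty {ι J : Type*} [Fintype ι] [Nonempty ι]
    {M : Matrix J J ℝ} (hM : M.PosSemidef) :
    (psdDecompositions ι M).Nonempty := by
  refine ⟨fun _ => (Fintype.card ι : ℝ)⁻¹ • M, fun _ => hM.smul (by positivity), ?_⟩
  rw [Finset.sum_const, Finset.card_univ, ← Nat.cast_smul_eq_nsmul ℝ, smul_smul,
    mul_inv_cancel₀ (by simp), one_smul]

section Conic

variable {ι J : Type*} [Fintype ι] [Fintype J]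

theorem isClosed_posSemidef : IsClosed {X : Matrix J J ℝ | X.PosSemidef} := by
  have : {X : Matrix J J ℝ | X.PosSemidef}
      = {X | Xᵀ = X} ∩ ⋂ x : J → ℝ, {X | 0 ≤ x ⬝ᵥ (X *ᵥ x)} := by
    ext X
    simp [posSemidef_iff_real, IsSymm]
  rw [this]
  refine (isClosed_eq (by fun_prop) (by fun_prop)).inter (isClosed_iInter fun x => ?_)
  exact isClosed_le (by fun_prop) (by fun_prop)

/-- The entries of a positive semidefinite matrix are bounded by its diagonal. -/
theorem Matrix.PosSemidef.abs_apply_le {X : Matrix J J ℝ} (hX : X.PosSemidef) (j k : J) :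
    |X j k| ≤ X j j + X k k := by
  classical
  have hsymm : X k j = X j k := by simpa using hX.isHermitian.apply j k
  have h1 := hX.quadratic_nonneg (Pi.single j 1 + Pi.single k 1)
  have h2 := hX.quadratic_nonneg (Pi.single j 1 - Pi.single k 1)
  have hj : 0 ≤ X j j := hX.diag_nonneg
  have hk : 0 ≤ X k k := hX.diag_nonneg
  simp [mulVec_add, mulVec_sub, add_dotProduct, sub_dotProduct] at h1 h2
  rw [abs_le]
  constructor <;> linarith

theorem isCompact_psdDecompositions (M : Matrix J J ℝ) : IsCompact (psdDecompositions ι M) := by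
  have hclosed : IsClosed (psdDecompositions ι M) := by
    refine IsClosed.inter ?_ (isClosed_eq (by fun_prop) (by fun_prop))
    have : {X : ι → Matrix J J ℝ | ∀ i, (X i).PosSemidef}
        = ⋂ i, (fun X => X i) ⁻¹' {X : Matrix J J ℝ | X.PosSemidef} := by
      ext; simp
    change IsClosed {X : ι → Matrix J J ℝ | ∀ i, (X i).PosSemidef}
    rw [this]
    exact isClosed_iInter fun i => isClosed_posSemidef.preimage (continuous_apply i)
  have hbox : IsCompact (Set.univ.pi fun _ : ι => Set.univ.pi fun j : J => Set.univ.pi fun k : J =>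
      Set.Icc (-(M j j + M k k)) (M j j + M k k)) :=
    isCompact_univ_pi fun _ => isCompact_univ_pi fun _ => isCompact_univ_pi fun _ => isCompact_Icc
  refine hbox.of_isClosed_subset hclosed ?_
  intro (X : ι → Matrix J J ℝ) hXM i _ j _ k _
  obtain ⟨hX, hsum⟩ := hXM
  have hdiag : ∀ l, X i l l ≤ M l l := by
    intro l
    rw [← hsum, Matrix.sum_apply]
    exact Finset.single_le_sum (f := fun i => X i l l) (fun i _ => (hX i).diag_nonneg)
      (Finset.mem_univ i)
  rw [Set.mem_Icc, ← abs_le]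
  exact ((hX i).abs_apply_le j k).trans (add_le_add (hdiag j) (hdiag k))

/-- A positive definite matrix is an order unit for the cone of positive semidefinite matrices. -/
theorem Matrix.PosDef.exists_smul_add_posSemidef [Nonempty J] {M : Matrix J J ℝ} (hM : M.PosDef)
    {Y : Matrix J J ℝ} (hY : Y.IsSymm) : ∃ a : ℝ, (a • M + Y).PosSemidef := by
  have hS : IsCompact (Metric.sphere (0 : J → ℝ) 1) := isCompact_sphere 0 1
  have hSne : (Metric.sphere (0 : J → ℝ) 1).Nonempty := NormedSpace.sphere_nonempty.mpr zero_le_one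
  obtain ⟨x₀, hx₀, hmin⟩ := hS.exists_isMinOn hSne
    (f := fun x => x ⬝ᵥ (M *ᵥ x)) (Continuous.continuousOn (by fun_prop))
  obtain ⟨x₁, hx₁, hmin₁⟩ := hS.exists_isMinOn hSne
    (f := fun x => x ⬝ᵥ (Y *ᵥ x)) (Continuous.continuousOn (by fun_prop))
  set ε := x₀ ⬝ᵥ (M *ᵥ x₀) with hε
  set C := x₁ ⬝ᵥ (Y *ᵥ x₁) with hC
  have hx₀ne : x₀ ≠ 0 := by
    rintro rfl
    simp at hx₀
  have hεpos : 0 < ε := by simpa using hM.dotProduct_mulVec_pos hx₀ne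
  have hMs : Mᵀ = M := by simpa [IsHermitian] using hM.isHermitian
  refine ⟨|C| / ε, posSemidef_iff_real.mpr ⟨?_, fun x => ?_⟩⟩
  · rw [IsSymm, transpose_add, transpose_smul, hMs, hY]
  by_cases hx : x = 0
  · simp [hx]
  have hxn : 0 < ‖x‖ := norm_pos_iff.mpr hx
  have hmem : ‖x‖⁻¹ • x ∈ Metric.sphere (0 : J → ℝ) 1 := by
    simp [norm_smul, hxn.ne']
  have h1 : ε ≤ ‖x‖⁻¹ * (‖x‖⁻¹ * (x ⬝ᵥ (M *ᵥ x))) := by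
    simpa [mulVec_smul] using hmin hmem
  have h2 : C ≤ ‖x‖⁻¹ * (‖x‖⁻¹ * (x ⬝ᵥ (Y *ᵥ x))) := by
    simpa [mulVec_smul] using hmin₁ hmem
  have h3 : 0 ≤ ‖x‖⁻¹ * (‖x‖⁻¹ * (|C| / ε * (x ⬝ᵥ (M *ᵥ x)) + x ⬝ᵥ (Y *ᵥ x))) := by
    have h4 : |C| / ε * ε ≤ |C| / ε * (‖x‖⁻¹ * (‖x‖⁻¹ * (x ⬝ᵥ (M *ᵥ x)))) := by gcongr
    rw [div_mul_cancel₀ _ hεpos.ne'] at h4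
    have h5 := neg_abs_le C
    calc 0 ≤ |C| / ε * (‖x‖⁻¹ * (‖x‖⁻¹ * (x ⬝ᵥ (M *ᵥ x))))
          + ‖x‖⁻¹ * (‖x‖⁻¹ * (x ⬝ᵥ (Y *ᵥ x))) := by linarith
      _ = _ := by ring
  have hinv : 0 < ‖x‖⁻¹ := inv_pos.mpr hxn
  rw [add_mulVec, dotProduct_add, smul_mulVec, dotProduct_smul, smul_eq_mul]
  exact nonneg_of_mul_nonneg_right (nonneg_of_mul_nonneg_right h3 hinv) hinv

/-- Strong duality for the maximization of `∑ i, c i (X i)` over the decompositions of a positive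
definite matrix `M` into positive semidefinite matrices: an optimal value `z` is matched by a
linear functional dominating every `c i` on the cone and equal to `z` at `M`. The functional comes
from the M. Riesz extension theorem, whose density condition holds since `M` is an order unit. -/
theorem exists_linear_majorant (c : ι → Matrix J J ℝ →ₗ[ℝ] ℝ) {M : Matrix J J ℝ}
    (hM : M.PosDef) (j₀ : J) (hj₀ : M j₀ j₀ = 1) {z : ℝ}
    (hz : ∀ X ∈ psdDecompositions ι M, ∑ i, c i (X i) ≤ z) :
    ∃ L : Matrix J J ℝ →ₗ[ℝ] ℝ, L M = z ∧
      ∀ i, ∀ X : Matrix J J ℝ, X.PosSemidef → c i X ≤ L X := by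
  classical
  have : Nonempty J := ⟨j₀⟩
  by_cases hι : Nonempty ι
  swap
  · have hz0 := not_nonempty_iff.mp hι
    refine ⟨z • (Matrix.entryLinearMap ℝ ℝ j₀ j₀), ?_, fun i => (hz0.false i).elim⟩
    simp [hj₀]
  have hMs : Mᵀ = M := by simpa [IsHermitian] using hM.isHermitian
  let s : PointedCone ℝ (Matrix J J ℝ × ℝ) :=
    { carrier := {q | ∃ X : ι → Matrix J J ℝ, (∀ i, (X i).PosSemidef) ∧
        ∑ i, X i = (2⁻¹ : ℝ) • (q.1 + q.1ᵀ) ∧ q.2 ≤ ∑ i, c i (X i)}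
      add_mem' := by
        rintro q q' ⟨X, hX, hs, hr⟩ ⟨X', hX', hs', hr'⟩
        refine ⟨X + X', fun i => (hX i).add (hX' i), ?_, ?_⟩
        · simp only [Pi.add_apply, Finset.sum_add_distrib, hs, hs', Prod.fst_add, transpose_add]
          module
        · simp only [Pi.add_apply, map_add, Finset.sum_add_distrib, Prod.snd_add]
          exact add_le_add hr hr'
      zero_mem' := ⟨0, fun _ => PosSemidef.zero, by simp, by simp⟩
      smul_mem' := by
        rintro ⟨a, ha⟩ q ⟨X, hX, hs, hr⟩
        refine ⟨a • X, fun i => (hX i).smul ha, ?_, ?_⟩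
        · change ∑ i, a • X i = (2⁻¹ : ℝ) • (a • q.1 + (a • q.1)ᵀ)
          rw [← Finset.smul_sum, hs, transpose_smul]
          module
        · change a * q.2 ≤ ∑ i, c i (a • X i)
          simp only [map_smul, smul_eq_mul, ← Finset.mul_sum]
          exact mul_le_mul_of_nonneg_left hr ha }
  have hmem : ∀ q : Matrix J J ℝ × ℝ, q ∈ s ↔ ∃ X : ι → Matrix J J ℝ, (∀ i, (X i).PosSemidef) ∧
        ∑ i, X i = (2⁻¹ : ℝ) • (q.1 + q.1ᵀ) ∧ q.2 ≤ ∑ i, c i (X i) := fun q => Iff.rfl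
  -- The functional `(a M, r) ↦ a z - r`, where `a` is read off from the entry at `j₀`.
  let f₀ : Matrix J J ℝ × ℝ →ₗ[ℝ] ℝ :=
    z • (Matrix.entryLinearMap ℝ ℝ j₀ j₀ ∘ₗ LinearMap.fst ℝ (Matrix J J ℝ) ℝ)
      - LinearMap.snd ℝ _ _
  have hf₀ : ∀ q, f₀ q = z * q.1 j₀ j₀ - q.2 := fun q => by simp [f₀]
  let p : Submodule ℝ (Matrix J J ℝ × ℝ) := (Submodule.span ℝ {M}).prod ⊤
  have hsym : ∀ a : ℝ, (2⁻¹ : ℝ) • (a • M + (a • M)ᵀ) = a • M := fun a => by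
    rw [transpose_smul, hMs]
    module
  obtain ⟨g, hgf, hg⟩ := riesz_extension s ⟨p, f₀ ∘ₗ p.subtype⟩ (by
      rintro ⟨⟨Y, r⟩, hq⟩ hqs
      obtain ⟨a, rfl⟩ := Submodule.mem_span_singleton.mp (Submodule.mem_prod.mp hq).1
      obtain ⟨X, hX, hs, hr⟩ := (hmem _).mp hqs
      simp only [hsym] at hs hr
      change 0 ≤ f₀ (a • M, r)
      have hval : f₀ (a • M, r) = z * a - r := by simp [hf₀, hj₀]
      rw [hval]
      have ha : 0 ≤ a := by
        have := congrFun (congrFun hs j₀) j₀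
        rw [Matrix.sum_apply, Matrix.smul_apply, hj₀, smul_eq_mul, mul_one] at this
        rw [← this]
        exact Finset.sum_nonneg fun i _ => (hX i).diag_nonneg
      rcases ha.eq_or_lt with rfl | ha
      · -- a decomposition of zero is zero
        have hX0 : ∀ i, X i = 0 := by
          intro i
          have hd : ∀ l, X i l l = 0 := by
            intro l
            have h1 := congrFun (congrFun hs l) l
            rw [Matrix.sum_apply, zero_smul, Matrix.zero_apply] at h1
            exact (Finset.sum_eq_zero_iff_of_nonneg fun i _ => (hX i).diag_nonneg).mp h1 i
              (Finset.mem_univ i)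
          ext j k
          have := (hX i).abs_apply_le j k
          rw [hd, hd, add_zero] at this
          simpa using abs_nonpos_iff.mp this
        simp only [hX0, map_zero, Finset.sum_const_zero] at hr
        linarith
      · have h1 := hz (fun i => a⁻¹ • X i) ⟨fun i => (hX i).smul (inv_pos.mpr ha).le, by
          rw [← Finset.smul_sum, hs, smul_smul, inv_mul_cancel₀ ha.ne', one_smul]⟩
        simp only [map_smul, smul_eq_mul, ← Finset.mul_sum] at h1
        rw [inv_mul_le_iff₀ ha] at h1
        linarith) (by
      rintro ⟨Y, r⟩
      have hYs : ((2⁻¹ : ℝ) • (Y + Yᵀ)).IsSymm := by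
        rw [IsSymm, transpose_smul, transpose_add, transpose_transpose, add_comm]
      obtain ⟨a, ha⟩ := hM.exists_smul_add_posSemidef hYs
      obtain ⟨i₀⟩ := hι
      let Z := a • M + (2⁻¹ : ℝ) • (Y + Yᵀ)
      refine ⟨⟨(a • M, c i₀ Z - r), Submodule.mem_prod.mpr
        ⟨Submodule.smul_mem _ _ (Submodule.mem_span_singleton_self M), trivial⟩⟩, ?_⟩
      refine (hmem _).mpr ⟨Pi.single i₀ Z, fun i => ?_, ?_, ?_⟩
      · by_cases hi : i = i₀
        · subst hi
          rw [Pi.single_eq_same]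
          exact ha
        · simpa [hi] using PosSemidef.zero
      · rw [Finset.sum_pi_single']
        simp only [Finset.mem_univ, if_true, Prod.fst_add, transpose_add, Z, transpose_smul, hMs]
        module
      · rw [Finset.sum_eq_single i₀ (fun i _ hi => by simp [hi]) (by simp)]
        simp)
  refine ⟨g ∘ₗ LinearMap.inl ℝ _ _, ?_, fun i X hX => ?_⟩
  · have := hgf ⟨(M, 0), Submodule.mem_prod.mpr ⟨Submodule.mem_span_singleton_self M, trivial⟩⟩
    change g (M, 0) = f₀ (M, 0) at this
    rw [LinearMap.comp_apply, LinearMap.inl_apply, this, hf₀]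
    simp [hj₀]
  · have hXs : Xᵀ = X := by simpa [IsHermitian] using hX.isHermitian
    have h1 := hg (X, c i X) ((hmem _).mpr ⟨Pi.single i X, fun k => ?_, ?_, ?_⟩)
    · have h2 := hgf ⟨(0, 1), Submodule.mem_prod.mpr ⟨Submodule.zero_mem _, trivial⟩⟩
      change g (0, 1) = f₀ (0, 1) at h2
      have h3 : g (X, c i X) = g (X, 0) + c i X * g (0, 1) := by
        rw [← smul_eq_mul, ← map_smul, ← map_add]
        simp
      have h4 : g (0, 1) = -1 := by rw [h2, hf₀]; simp
      rw [h3, h4] at h1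
      rw [LinearMap.comp_apply, LinearMap.inl_apply]
      linarith
    · by_cases hk : k = i
      · subst hk
        simpa using hX
      · simpa [hk] using PosSemidef.zero
    · rw [Finset.sum_pi_single']
      simp only [Finset.mem_univ, if_true, hXs]
      module
    · rw [Finset.sum_eq_single i (fun k _ hk => by simp [hk]) (by simp)]
      simp

end Conic

/-! ### Bordered matrices -/

section Bordered

variable {n : ℕ}

/-- The symmetric matrix `[S, m; mᵀ, p]`. With `p = 1` it is the matrix of moments up to order two
of a law with mean `m` and second moment matrix `S`. -/
def bordered (S : Matrix (Fin n) (Fin n) ℝ) (m : Fin n → ℝ) (p : ℝ) :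
    Matrix (Fin n ⊕ Unit) (Fin n ⊕ Unit) ℝ :=
  fromBlocks S (replicateCol Unit m) (replicateRow Unit m) (of fun _ _ => p)

theorem bordered_quadratic (S : Matrix (Fin n) (Fin n) ℝ) (m : Fin n → ℝ) (p : ℝ)
    (ξ : Fin n → ℝ) (t : ℝ) :
    Sum.elim ξ (fun _ => t) ⬝ᵥ (bordered S m p *ᵥ Sum.elim ξ fun _ => t)
      = ξ ⬝ᵥ (S *ᵥ ξ) + 2 * t * (m ⬝ᵥ ξ) + t ^ 2 * p := by
  have h1 : replicateCol Unit m *ᵥ (fun _ => t) = t • m := by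
    ext j
    simp [mulVec, dotProduct, mul_comm]
  have h2 : replicateRow Unit m *ᵥ ξ = fun _ => m ⬝ᵥ ξ := by
    ext j
    simp [mulVec, dotProduct]
  have h3 : (of fun _ _ => p : Matrix Unit Unit ℝ) *ᵥ (fun _ => t) = fun _ => p * t := by
    ext j
    simp [mulVec, dotProduct]
  rw [bordered, fromBlocks_mulVec, sumElim_dotProduct_sumElim]
  simp only [Sum.elim_comp_inl, Sum.elim_comp_inr, h1, h2, h3]
  rw [dotProduct_add, dotProduct_smul, dotProduct_comm ξ m]
  simp [dotProduct]
  ring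

theorem bordered_isSymm {S : Matrix (Fin n) (Fin n) ℝ} {m : Fin n → ℝ} {p : ℝ} :
    (bordered S m p).IsSymm ↔ S.IsSymm := by
  rw [bordered, isSymm_fromBlocks_iff]
  constructor
  · exact fun h => h.1
  · exact fun h => ⟨h, by ext; simp, by ext; simp, by ext; simp⟩

theorem exists_eq_sumElim (x : Fin n ⊕ Unit → ℝ) :
    ∃ (ξ : Fin n → ℝ) (t : ℝ), x = Sum.elim ξ fun _ => t :=
  ⟨fun j => x (.inl j), x (.inr ()), by ext (j | j) <;> rfl⟩

theorem bordered_posSemidef_iff {S : Matrix (Fin n) (Fin n) ℝ} {m : Fin n → ℝ} {p : ℝ} :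
    (bordered S m p).PosSemidef ↔ S.IsSymm ∧
      ∀ ξ t, 0 ≤ ξ ⬝ᵥ (S *ᵥ ξ) + 2 * t * (m ⬝ᵥ ξ) + t ^ 2 * p := by
  rw [posSemidef_iff_real, bordered_isSymm]
  refine and_congr_right fun _ => ⟨fun h ξ t => ?_, fun h x => ?_⟩
  · rw [← bordered_quadratic]
    exact h _
  · obtain ⟨ξ, t, rfl⟩ := exists_eq_sumElim x
    rw [bordered_quadratic]
    exact h ξ t

/-- A quadratic function is nonnegative on the whole space iff its bordered matrix is positive
semidefinite: the form at `(ξ, t)` is `t²` times the function at `ξ / t`, and at `t = 0` it is the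
leading coefficient of the function along the line spanned by `ξ`. -/
theorem quadratic_nonneg_iff_bordered_posSemidef {S : Matrix (Fin n) (Fin n) ℝ} (hS : S.IsSymm)
    (m : Fin n → ℝ) (p : ℝ) :
    (∀ ξ, 0 ≤ ξ ⬝ᵥ (S *ᵥ ξ) + 2 * (m ⬝ᵥ ξ) + p) ↔ (bordered S m p).PosSemidef := by
  rw [bordered_posSemidef_iff]
  refine ⟨fun h => ⟨hS, fun ξ t => ?_⟩, fun h ξ => by simpa using h.2 ξ 1⟩
  have hscale : ∀ s : ℝ, 0 ≤ s ^ 2 * (ξ ⬝ᵥ (S *ᵥ ξ)) + 2 * s * (m ⬝ᵥ ξ) + p := by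
    intro s
    have := h (s • ξ)
    simp only [mulVec_smul, dotProduct_smul, smul_dotProduct, smul_eq_mul] at this
    linarith
  by_cases ht : t = 0
  · subst ht
    have hnn : 0 ≤ ξ ⬝ᵥ (S *ᵥ ξ) := by
      set A := ξ ⬝ᵥ (S *ᵥ ξ)
      set B := m ⬝ᵥ ξ
      by_contra hA
      push Not at hA
      -- the sum of the values at `s` and `-s` is `2 (s² A + p)`, which is negative for large `s`
      have h1 := hscale (1 + |p| / -A)
      have h2 := hscale (-(1 + |p| / -A))
      have h3 : |p| / -A * -A = |p| := div_mul_cancel₀ _ (by linarith)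
      have h4 : 0 ≤ |p| / -A := div_nonneg (abs_nonneg _) (by linarith)
      nlinarith [le_abs_self p, mul_nonneg h4 h4, mul_nonneg h4 (mul_nonneg h4 (neg_pos.mpr hA).le)]
    simpa using hnn
  · have h1 := mul_nonneg (sq_nonneg t) (hscale t⁻¹)
    have h2 : t ^ 2 * (t⁻¹ ^ 2 * (ξ ⬝ᵥ (S *ᵥ ξ)) + 2 * t⁻¹ * (m ⬝ᵥ ξ) + p)
        = ξ ⬝ᵥ (S *ᵥ ξ) + 2 * t * (m ⬝ᵥ ξ) + t ^ 2 * p := by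
      field_simp
    rwa [h2] at h1

theorem dotProduct_vecMulVec_mulVec (m m' ξ : Fin n → ℝ) :
    ξ ⬝ᵥ (vecMulVec m m' *ᵥ ξ) = (m ⬝ᵥ ξ) * (m' ⬝ᵥ ξ) := by
  rw [vecMulVec_mulVec]
  simp [dotProduct_comm ξ m, mul_comm]

/-- The matrix of moments is positive definite when the covariance matrix is. -/
theorem bordered_moments_posDef {Sigma : Matrix (Fin n) (Fin n) ℝ} (hSigma : Sigma.PosDef)
    (xbar : Fin n → ℝ) : (bordered (Sigma + vecMulVec xbar xbar) xbar 1).PosDef := by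
  have hs : Sigma.IsSymm := by simpa [IsHermitian, IsSymm] using hSigma.isHermitian
  refine PosDef.of_dotProduct_mulVec_pos ?_ fun {x} hx => ?_
  · have : (bordered (Sigma + vecMulVec xbar xbar) xbar 1).IsSymm := by
      rw [bordered_isSymm, IsSymm, transpose_add, hs, transpose_vecMulVec]
    simpa [IsHermitian] using this.eq
  · obtain ⟨ξ, t, rfl⟩ := exists_eq_sumElim x
    rw [star_trivial, bordered_quadratic, add_mulVec, dotProduct_add, dotProduct_vecMulVec_mulVec]
    have hsq : ξ ⬝ᵥ (Sigma *ᵥ ξ) + xbar ⬝ᵥ ξ * xbar ⬝ᵥ ξ + 2 * t * xbar ⬝ᵥ ξ + t ^ 2 * 1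
        = ξ ⬝ᵥ (Sigma *ᵥ ξ) + (xbar ⬝ᵥ ξ + t) ^ 2 := by ring
    rw [hsq]
    by_cases hξ : ξ = 0
    · subst hξ
      have ht : t ≠ 0 := by
        rintro rfl
        exact hx (by ext (j | j) <;> rfl)
      simpa using pow_pos (abs_pos.mpr ht) 2
    · have := hSigma.dotProduct_mulVec_pos hξ
      rw [star_trivial] at this
      positivity

theorem bordered_corner_nonneg {S : Matrix (Fin n) (Fin n) ℝ} {m : Fin n → ℝ} {p : ℝ}
    (h : (bordered S m p).PosSemidef) : 0 ≤ p := by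
  simpa using (bordered_posSemidef_iff.mp h).2 0 1

theorem bordered_border_eq_zero {S : Matrix (Fin n) (Fin n) ℝ} {m : Fin n → ℝ} {p : ℝ}
    (h : (bordered S m p).PosSemidef) (hp : p = 0) : m = 0 := by
  subst hp
  have h1 := (bordered_posSemidef_iff.mp h).2 m
  by_contra hm
  have hpos : 0 < m ⬝ᵥ m := by simpa using dotProduct_star_self_pos_iff.mpr hm
  have h2 := h1 (-(m ⬝ᵥ (S *ᵥ m) + 1) / (2 * (m ⬝ᵥ m)))
  have h3 : 2 * (-(m ⬝ᵥ (S *ᵥ m) + 1) / (2 * (m ⬝ᵥ m))) * (m ⬝ᵥ m)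
      = -(m ⬝ᵥ (S *ᵥ m) + 1) := by
    field_simp
  rw [h3] at h2
  linarith

/-- The Schur complement of the corner. For `p = 0` the border vanishes, so that the convention
`0⁻¹ = 0` gives the right matrix. -/
theorem bordered_schur_posSemidef {S : Matrix (Fin n) (Fin n) ℝ} {m : Fin n → ℝ} {p : ℝ}
    (h : (bordered S m p).PosSemidef) : (S - p⁻¹ • vecMulVec m m).PosSemidef := by
  obtain ⟨hS, h1⟩ := bordered_posSemidef_iff.mp h
  refine posSemidef_iff_real.mpr ⟨?_, fun ξ => ?_⟩
  · rw [IsSymm, transpose_sub, transpose_smul, transpose_vecMulVec, hS]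
  rw [sub_mulVec, smul_mulVec, dotProduct_sub, dotProduct_smul, dotProduct_vecMulVec_mulVec,
    smul_eq_mul]
  by_cases hp : p = 0
  · simpa [hp] using h1 ξ 0
  · have h2 := h1 ξ (-(p⁻¹ * (m ⬝ᵥ ξ)))
    have h3 : ξ ⬝ᵥ (S *ᵥ ξ) + 2 * -(p⁻¹ * (m ⬝ᵥ ξ)) * (m ⬝ᵥ ξ) + (-(p⁻¹ * (m ⬝ᵥ ξ))) ^ 2 * p
        = ξ ⬝ᵥ (S *ᵥ ξ) - p⁻¹ * ((m ⬝ᵥ ξ) * (m ⬝ᵥ ξ)) := by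
      field_simp
      ring
    rwa [h3] at h2

theorem eq_bordered {X : Matrix (Fin n ⊕ Unit) (Fin n ⊕ Unit) ℝ} (hX : X.IsSymm) :
    X = bordered X.toBlocks₁₁ (fun j => X (.inl j) (.inr ())) (X (.inr ()) (.inr ())) := by
  ext (j | j) (k | k)
  · rfl
  · rfl
  · exact hX.apply _ _
  · rfl

/-- Linear functionals on bordered matrices: the coefficients form a quadratic function. -/
theorem exists_coeffs_of_linear
    (L : Matrix (Fin n ⊕ Unit) (Fin n ⊕ Unit) ℝ →ₗ[ℝ] ℝ) :
    ∃ (H : Matrix (Fin n) (Fin n) ℝ) (h : Fin n → ℝ) (h0 : ℝ), H.IsSymm ∧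
      ∀ (S : Matrix (Fin n) (Fin n) ℝ) (m : Fin n → ℝ) (p : ℝ), S.IsSymm →
        L (bordered S m p) = (Hᵀ * S).trace + h ⬝ᵥ m + h0 * p := by
  classical
  let e : (Fin n ⊕ Unit) → (Fin n ⊕ Unit) → ℝ := fun j k => L (Matrix.single j k 1)
  have hL : ∀ X, L X = ∑ j, ∑ k, X j k * e j k := by
    intro X
    conv_lhs => rw [matrix_eq_sum_single X]
    simp only [map_sum]
    refine Finset.sum_congr rfl fun j _ => Finset.sum_congr rfl fun k _ => ?_
    rw [← smul_eq_mul, ← map_smul, smul_single, smul_eq_mul, mul_one]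
  refine ⟨of fun j k => (e (.inl j) (.inl k) + e (.inl k) (.inl j)) / 2,
    fun j => e (.inl j) (.inr ()) + e (.inr ()) (.inl j), e (.inr ()) (.inr ()), ?_, ?_⟩
  · ext j k
    simp [add_comm]
  · intro S m p hS
    have hsw : ∑ j, ∑ k, S j k * e (.inl k) (.inl j) = ∑ j, ∑ k, S j k * e (.inl j) (.inl k) := by
      rw [Finset.sum_comm]
      exact Finset.sum_congr rfl fun j _ => Finset.sum_congr rfl fun k _ => by rw [hS.apply]
    have htr : ((of fun j k => (e (.inl j) (.inl k) + e (.inl k) (.inl j)) / 2)ᵀ * S).trace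
        = ∑ j, ∑ k, S j k * e (.inl j) (.inl k) := by
      have : ((of fun j k => (e (.inl j) (.inl k) + e (.inl k) (.inl j)) / 2)ᵀ * S).trace
          = (∑ j, ∑ k, S j k * e (.inl j) (.inl k)
            + ∑ j, ∑ k, S j k * e (.inl k) (.inl j)) / 2 := by
        simp only [trace, diag_apply, mul_apply, transpose_apply, of_apply]
        rw [Finset.sum_comm, ← Finset.sum_add_distrib, Finset.sum_div]
        refine Finset.sum_congr rfl fun j _ => ?_
        rw [← Finset.sum_add_distrib, Finset.sum_div]
        exact Finset.sum_congr rfl fun k _ => by ring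
      rw [this, hsw]
      ring
    rw [htr, hL]
    simp only [bordered, Fintype.sum_sum_type, fromBlocks_apply₁₁, fromBlocks_apply₁₂,
      fromBlocks_apply₂₁, fromBlocks_apply₂₂, Finset.univ_unique, Finset.sum_singleton,
      replicateCol_apply, replicateRow_apply, of_apply, dotProduct, Finset.sum_add_distrib,
      add_mul, mul_comm (m _), PUnit.default_eq_unit]
    ring

end Bordered

/-! ### Finitely supported laws with prescribed moments -/

section Discrete

theorem integrable_finite_sum_dirac {κ E : Type*} [Fintype κ] [MeasurableSpace E]
    [MeasurableSingletonClass E] (w : κ → ℝ) (y : κ → E) (f : E → ℝ) :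
    Integrable f (∑ k, ENNReal.ofReal (w k) • Measure.dirac (y k)) := by
  rw [integrable_finsetSum_measure]
  exact fun k _ => (integrable_dirac (by simp)).smul_measure ENNReal.ofReal_ne_top

theorem integral_finite_sum_dirac {κ E : Type*} [Fintype κ] [MeasurableSpace E]
    [MeasurableSingletonClass E] {w : κ → ℝ} (hw : ∀ k, 0 ≤ w k) (y : κ → E) (f : E → ℝ) :
    ∫ x, f x ∂(∑ k, ENNReal.ofReal (w k) • Measure.dirac (y k)) = ∑ k, w k * f (y k) := by
  rw [integral_finsetSum_measure fun k _ =>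
    (integrable_dirac (by simp)).smul_measure ENNReal.ofReal_ne_top]
  refine Finset.sum_congr rfl fun k _ => ?_
  rw [integral_smul_measure, integral_dirac, ENNReal.toReal_ofReal (hw k), smul_eq_mul]

variable {n : ℕ} {ι : Type*} [Fintype ι]

/-- Given masses `p i` at the points `p i⁻¹ • m i` and a positive semidefinite matrix `R`, there is
a law with the moments of this point distribution convolved with centred noise of covariance `R`.
Since the noise is centred, the expectation of a function that dominates the affine functions
`a i + b i ⬝ᵥ ξ` is at least `∑ i, (a i * p i + b i ⬝ᵥ m i)`. -/
theorem exists_measure_of_masses (p : ι → ℝ) (m : ι → Fin n → ℝ) (hp : ∀ i, 0 ≤ p i)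
    (hp1 : ∑ i, p i = 1) (hpm : ∀ i, p i = 0 → m i = 0)
    {R : Matrix (Fin n) (Fin n) ℝ} (hR : R.PosSemidef) :
    ∃ P : Measure (Fin n → ℝ), IsProbabilityMeasure P ∧
      (∀ f : (Fin n → ℝ) → ℝ, Integrable f P) ∧
      (∀ j, ∫ ξ, ξ j ∂P = ∑ i, m i j) ∧
      (∀ j k, ∫ ξ, ξ j * ξ k ∂P = R j k + ∑ i, (p i)⁻¹ * (m i j * m i k)) ∧
      ∀ (a : ι → ℝ) (b : ι → Fin n → ℝ) (q : (Fin n → ℝ) → ℝ),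
        (∀ i ξ, a i + b i ⬝ᵥ ξ ≤ q ξ) → ∑ i, (a i * p i + b i ⬝ᵥ m i) ≤ ∫ ξ, q ξ ∂P := by
  obtain ⟨N₀, r₀, hr₀⟩ := posSemidef_iff_eq_sum_vecMulVec.mp hR
  -- a zero vector is adjoined, so that the number `N` of vectors is positive
  let r : Fin (N₀ + 1) → Fin n → ℝ := Fin.cons 0 r₀
  have hr : ∀ j k, R j k = ∑ l, r l j * r l k := by
    intro j k
    rw [hr₀, Fin.sum_univ_succ, Matrix.sum_apply]
    simp [r, vecMulVec_apply]
  set N : ℝ := ((N₀ + 1 : ℕ) : ℝ) with hN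
  have hNpos : 0 < N := by rw [hN]; positivity
  let w : ι × Fin (N₀ + 1) × Bool → ℝ := fun k => p k.1 / (2 * N)
  let y : ι × Fin (N₀ + 1) × Bool → Fin n → ℝ := fun k =>
    (p k.1)⁻¹ • m k.1 + (if k.2.2 then √N else -√N) • r k.2.1
  have hw : ∀ k, 0 ≤ w k := fun k => div_nonneg (hp _) (by positivity)
  have hsum : ∀ (F : (Fin n → ℝ) → ℝ) (α : ι → ℝ) (β : Fin (N₀ + 1) → ℝ),
      (∀ i l, F ((p i)⁻¹ • m i + √N • r l) + F ((p i)⁻¹ • m i + (-√N) • r l)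
        = 2 * (α i + N * β l)) →
      ∑ k, w k * F (y k) = ∑ i, p i * α i + ∑ l, β l := by
    intro F α β hF
    rw [Fintype.sum_prod_type]
    have hi : ∀ i, ∑ k : Fin (N₀ + 1) × Bool, w (i, k) * F (y (i, k))
        = p i * α i + p i * ∑ l, β l := by
      intro i
      rw [Fintype.sum_prod_type]
      have hl : ∀ l, ∑ s : Bool, w (i, l, s) * F (y (i, l, s)) = p i * α i / N + p i * β l := by
        intro l
        rw [Fintype.sum_bool]
        simp only [w, y, if_true, Bool.false_eq_true, if_false]
        rw [← mul_add, hF]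
        field_simp
      rw [Finset.sum_congr rfl fun l _ => hl l, Finset.sum_add_distrib, Finset.sum_const,
        Finset.card_univ, Fintype.card_fin, nsmul_eq_mul, ← hN, mul_div_cancel₀ _ hNpos.ne',
        Finset.mul_sum]
    rw [Finset.sum_congr rfl fun i _ => hi i, Finset.sum_add_distrib, ← Finset.sum_mul, hp1,
      one_mul]
  have hmass : ∀ i, p i • (p i)⁻¹ • m i = m i := by
    intro i
    by_cases h : p i = 0
    · rw [hpm i h, smul_zero, smul_zero]
    · rw [smul_smul, mul_inv_cancel₀ h, one_smul]
  have hmass' : ∀ i j, p i * ((p i)⁻¹ * m i j) = m i j := fun i j => by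
    simpa using congrFun (hmass i) j
  have hsqrt : √N * √N = N := Real.mul_self_sqrt hNpos.le
  refine ⟨∑ k, ENNReal.ofReal (w k) • Measure.dirac (y k), ⟨?_⟩, integrable_finite_sum_dirac w y,
    fun j => ?_, fun j k => ?_, fun a b q hq => ?_⟩
  · have h1 := hsum (fun _ => 1) (fun _ => 1) (fun _ => 0) (fun _ _ => by norm_num)
    simp only [mul_one, hp1, Finset.sum_const_zero, add_zero] at h1
    simp only [Measure.coe_finsetSum, Finset.sum_apply, Measure.smul_apply, measure_univ,
      smul_eq_mul, mul_one]
    rw [← ENNReal.ofReal_sum_of_nonneg fun k _ => hw k, h1, ENNReal.ofReal_one]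
  · rw [integral_finite_sum_dirac hw, hsum (fun ξ => ξ j) (fun i => (p i)⁻¹ * m i j) (fun _ => 0)]
    · simp [hmass']
    · intro i l
      simp
      ring
  · rw [integral_finite_sum_dirac hw, hsum (fun ξ => ξ j * ξ k)
      (fun i => ((p i)⁻¹ * m i j) * ((p i)⁻¹ * m i k)) (fun l => r l j * r l k)]
    · rw [hr, add_comm]
      congr 1
      refine Finset.sum_congr rfl fun i _ => ?_
      rw [← mul_assoc, hmass']
      ring
    · intro i l
      simp only [Pi.add_apply, Pi.smul_apply, smul_eq_mul]
      linear_combination (2 * r l j * r l k) * hsqrt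
  · rw [integral_finite_sum_dirac hw]
    -- the affine function to be used depends on the atom, so the sum is bounded atom by atom
    have h2 : ∑ k : ι × Fin (N₀ + 1) × Bool, w k * (a k.1 + b k.1 ⬝ᵥ y k)
        = ∑ i, (a i * p i + b i ⬝ᵥ m i) := by
      rw [Fintype.sum_prod_type]
      refine Finset.sum_congr rfl fun i _ => ?_
      rw [Fintype.sum_prod_type]
      have hl : ∀ l, ∑ s : Bool, w (i, l, s) * (a i + b i ⬝ᵥ y (i, l, s))
          = (a i * p i + b i ⬝ᵥ m i) / N := by
        intro l
        have hbm : p i * ((p i)⁻¹ * (b i ⬝ᵥ m i)) = b i ⬝ᵥ m i := by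
          simpa only [dotProduct_smul, smul_eq_mul] using congrArg (b i ⬝ᵥ ·) (hmass i)
        rw [Fintype.sum_bool]
        simp only [w, y, if_true, Bool.false_eq_true, if_false, dotProduct_add, dotProduct_smul,
          smul_eq_mul]
        calc _ = (a i * p i + p i * ((p i)⁻¹ * (b i ⬝ᵥ m i))) / N := by
              generalize (p i)⁻¹ = t
              field_simp
              ring
          _ = _ := by rw [hbm]
      rw [Finset.sum_congr rfl fun l _ => hl l, Finset.sum_const, Finset.card_univ,
        Fintype.card_fin, nsmul_eq_mul, ← hN, mul_div_cancel₀ _ hNpos.ne']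
    rw [← h2]
    exact Finset.sum_le_sum fun k _ => mul_le_mul_of_nonneg_left (hq _ _) (hw k)

end Discrete

/-! ### Strong duality for the moment problem -/

/-- A finite maximum of affine functions is integrable if the coordinates are. -/
theorem integrable_of_isGreatest_affine {n : ℕ} {ι : Type*} [Fintype ι] [Nonempty ι]
    {a : ι → ℝ} {b : ι → Fin n → ℝ} {q : (Fin n → ℝ) → ℝ}
    (hq : ∀ ξ, IsGreatest (Set.range fun i => a i + b i ⬝ᵥ ξ) (q ξ))
    {P : Measure (Fin n → ℝ)} [IsFiniteMeasure P]
    (hP : ∀ j, Integrable (fun ξ : Fin n → ℝ => ξ j) P) : Integrable q P := by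
  have haff : ∀ i, Integrable (fun ξ : Fin n → ℝ => a i + b i ⬝ᵥ ξ) P := fun i =>
    (integrable_const _).add (integrable_finsetSum _ fun j _ => (hP j).const_mul _)
  have hsup : q = Finset.univ.sup' Finset.univ_nonempty fun i (ξ : Fin n → ℝ) => a i + b i ⬝ᵥ ξ := by
    ext ξ
    rw [Finset.sup'_apply]
    obtain ⟨⟨i, hi⟩, hub⟩ := hq ξ
    refine le_antisymm ?_ (Finset.sup'_le _ _ fun i _ => hub ⟨i, rfl⟩)
    rw [← hi]
    exact Finset.le_sup' (fun i => a i + b i ⬝ᵥ ξ) (Finset.mem_univ i)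
  rw [hsup]
  exact Finset.sup'_induction _ _ (p := fun f => Integrable f P) (fun _ h₁ _ h₂ => h₁.sup h₂)
    fun i _ => haff i

namespace UCData

variable {nx ny n nw mF mG mA mU : ℕ} (D : UCData nx ny n nw mF mG mA mU)

theorem Theta_apply (j k : Fin n) : D.Theta j k = D.Sigma j k + D.xbar j * D.xbar k := by
  simp [Theta, vecMulVec_apply]

/-- Under a law of the ambiguity set, the expectation of a quadratic function is its moment
objective. -/
theorem integral_quadFun {P : Measure (Fin n → ℝ)} (hP : P ∈ D.ambiguitySet)
    (H : Matrix (Fin n) (Fin n) ℝ) (h : Fin n → ℝ) (h0 : ℝ) :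
    Integrable (quadFun H h h0) P ∧ ∫ ξ, quadFun H h h0 ξ ∂P = D.momentObj H h h0 := by
  obtain ⟨hprob, h1, h2⟩ := hP
  have e : quadFun H h h0 = fun ξ : Fin n → ℝ =>
      (∑ j, ∑ k, H j k * (ξ j * ξ k) + ∑ j, h j * ξ j) + h0 := by
    ext ξ
    simp only [quadFun, dotProduct, mulVec, Finset.mul_sum]
    congr 2
    exact Finset.sum_congr rfl fun j _ => Finset.sum_congr rfl fun k _ => by ring
  have i2 : ∀ j k, Integrable (fun ξ : Fin n → ℝ => H j k * (ξ j * ξ k)) P :=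
    fun j k => (h2 j k).1.const_mul _
  have i1 : ∀ j, Integrable (fun ξ : Fin n → ℝ => h j * ξ j) P := fun j => (h1 j).1.const_mul _
  have I2 : Integrable (fun ξ : Fin n → ℝ => ∑ j, ∑ k, H j k * (ξ j * ξ k)) P :=
    integrable_finsetSum _ fun j _ => integrable_finsetSum _ fun k _ => i2 j k
  have I1 : Integrable (fun ξ : Fin n → ℝ => ∑ j, h j * ξ j) P :=
    integrable_finsetSum _ fun j _ => i1 j
  have I21 : Integrable (fun ξ : Fin n → ℝ =>
      ∑ j, ∑ k, H j k * (ξ j * ξ k) + ∑ j, h j * ξ j) P := I2.add I1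
  rw [e]
  refine ⟨I21.add (integrable_const _), ?_⟩
  beta_reduce
  rw [integral_add I21 (integrable_const _), integral_add I2 I1, integral_const,
    integral_finsetSum _ fun j _ => integrable_finsetSum _ fun k _ => i2 j k,
    integral_finsetSum _ fun j _ => i1 j]
  simp only [integral_finsetSum _ fun k _ => i2 _ k, integral_const_mul, (h1 _).2, (h2 _ _).2,
    probReal_univ, one_smul, momentObj, dotProduct]
  congr 2
  simp only [trace, diag_apply, mul_apply, transpose_apply]
  rw [Finset.sum_comm]
  simp only [Theta_apply]

theorem integral_le_momentObj {P : Measure (Fin n → ℝ)} (hP : P ∈ D.ambiguitySet)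
    {q : (Fin n → ℝ) → ℝ} (hq : Integrable q P) {H : Matrix (Fin n) (Fin n) ℝ} {h : Fin n → ℝ}
    {h0 : ℝ} (hle : ∀ ξ, q ξ ≤ quadFun H h h0 ξ) : ∫ ξ, q ξ ∂P ≤ D.momentObj H h h0 := by
  obtain ⟨hint, heq⟩ := D.integral_quadFun hP H h h0
  rw [← heq]
  exact integral_mono hq hint hle

/-- Strong duality for the moment problem of a finite maximum `q` of affine functions: some law and
some quadratic majorant of `q` have no duality gap. Both are read off from an optimal solution of
the semidefinite program that splits the matrix of moments among the affine pieces. -/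
theorem exists_law_and_majorant (hSigma : D.Sigma.PosDef) {ι : Type*} [Fintype ι] [Nonempty ι]
    {a : ι → ℝ} {b : ι → Fin n → ℝ} {q : (Fin n → ℝ) → ℝ}
    (hq : ∀ ξ, IsGreatest (Set.range fun i => a i + b i ⬝ᵥ ξ) (q ξ)) :
    ∃ P ∈ D.ambiguitySet, ∃ H h h0, H.IsSymm ∧ (∀ ξ, q ξ ≤ quadFun H h h0 ξ) ∧
      D.momentObj H h h0 ≤ ∫ ξ, q ξ ∂P := by
  let c : ι → Matrix (Fin n ⊕ Unit) (Fin n ⊕ Unit) ℝ →ₗ[ℝ] ℝ := fun i =>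
    a i • entryLinearMap ℝ ℝ (.inr ()) (.inr ())
      + ∑ j, b i j • entryLinearMap ℝ ℝ (.inl j) (.inr ())
  have hc : ∀ i X, c i X = a i * X (.inr ()) (.inr ()) + b i ⬝ᵥ fun j => X (.inl j) (.inr ()) := by
    intro i X
    simp [c, dotProduct, LinearMap.sum_apply]
  set M := bordered D.Theta D.xbar 1 with hMdef
  have hM : M.PosDef := bordered_moments_posDef hSigma D.xbar
  have hSs : D.Sigma.IsSymm := by simpa [IsHermitian, IsSymm] using hSigma.isHermitian
  have hTs : D.Theta.IsSymm := by
    rw [IsSymm, Theta, transpose_add, hSs, transpose_vecMulVec]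
  have hcont : Continuous fun X : ι → Matrix (Fin n ⊕ Unit) (Fin n ⊕ Unit) ℝ =>
      ∑ i, c i (X i) := by
    simp only [hc, dotProduct]
    fun_prop
  obtain ⟨X, ⟨hX, hXM⟩, hmax⟩ := (isCompact_psdDecompositions (ι := ι) M).exists_isMaxOn
    (psdDecompositions_nonempty hM.posSemidef) hcont.continuousOn
  -- the quadratic majorant
  obtain ⟨L, hLM, hL⟩ := exists_linear_majorant c hM (.inr ()) (by simp [hMdef, bordered])
    (fun Y hY => hmax hY)
  obtain ⟨H, h, h0, hH, hLH⟩ := exists_coeffs_of_linear L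
  -- the law
  let S : ι → Matrix (Fin n) (Fin n) ℝ := fun i => (X i).toBlocks₁₁
  let m : ι → Fin n → ℝ := fun i j => X i (.inl j) (.inr ())
  let p : ι → ℝ := fun i => X i (.inr ()) (.inr ())
  have hXb : ∀ i, (bordered (S i) (m i) (p i)).PosSemidef := by
    intro i
    have := hX i
    rwa [eq_bordered (X := X i) (by simpa [IsHermitian, IsSymm] using (hX i).isHermitian)] at this
  have hentry : ∀ j k, ∑ i, X i j k = M j k := fun j k => by rw [← hXM, Matrix.sum_apply]
  obtain ⟨P, hprob, hint, hmean, hsecond, hval⟩ := exists_measure_of_masses p m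
    (fun i => bordered_corner_nonneg (hXb i)) (hentry _ _) (fun i => bordered_border_eq_zero (hXb i))
    (posSemidef_sum Finset.univ fun i _ => bordered_schur_posSemidef (hXb i))
  refine ⟨P, ⟨hprob, fun j => ⟨hint _, ?_⟩, fun j k => ⟨hint _, ?_⟩⟩, H, h, h0, hH, fun ξ => ?_, ?_⟩
  · rw [hmean]
    exact hentry (.inl j) (.inr ())
  · rw [hsecond, Matrix.sum_apply, ← Finset.sum_add_distrib, ← Theta_apply]
    refine Eq.trans (Finset.sum_congr rfl fun i _ => ?_) (hentry (.inl j) (.inl k))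
    simp [S, vecMulVec_apply, toBlocks₁₁]
  · obtain ⟨⟨i, hi⟩, -⟩ := hq ξ
    have hsymm : (vecMulVec ξ ξ).IsSymm := transpose_vecMulVec ξ ξ
    have hpsd : (bordered (vecMulVec ξ ξ) ξ 1).PosSemidef := by
      refine bordered_posSemidef_iff.mpr ⟨hsymm, fun ζ t => ?_⟩
      rw [dotProduct_vecMulVec_mulVec]
      nlinarith [sq_nonneg (ξ ⬝ᵥ ζ + t)]
    have h1 := hL i _ hpsd
    rw [hLH _ _ _ hsymm, hc] at h1
    have h2 : (Hᵀ * vecMulVec ξ ξ).trace = ξ ⬝ᵥ (H *ᵥ ξ) := by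
      rw [mul_vecMulVec, trace_vecMulVec, hH, dotProduct_comm]
    rw [h2] at h1
    rw [← hi, quadFun]
    simpa [bordered] using h1
  · have h1 : D.momentObj H h h0 = ∑ i, c i (X i) := by
      rw [momentObj, ← mul_one h0, ← hLH _ _ _ hTs]
      exact hLM
    rw [h1]
    refine le_trans (le_of_eq ?_) (hval a b q fun i ξ => (hq ξ).2 ⟨i, rfl⟩)
    exact Finset.sum_congr rfl fun i _ => hc i (X i)

/-! ### Duality for the second-stage linear program -/

/-- The left-hand side of the equality constraints of the second-stage dual. -/
def dualConstraint : ((Fin mG → ℝ) × (Fin mA → ℝ) × (Fin mU → ℝ)) →ₗ[ℝ] (Fin ny → ℝ) where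
  toFun v := D.Gᵀ *ᵥ v.1 + D.Bᵀ *ᵥ v.2.1 + D.Uᵀ *ᵥ v.2.2
  map_add' v v' := by
    simp only [Prod.fst_add, Prod.snd_add, mulVec_add]
    abel
  map_smul' r v := by
    simp only [Prod.smul_fst, Prod.smul_snd, mulVec_smul, smul_add, RingHom.id_apply]

/-- The sign-constrained coordinates of the second-stage dual. -/
def dualCoord (mG mA mU : ℕ) :
    Fin mG ⊕ Fin mA → ((Fin mG → ℝ) × (Fin mA → ℝ) × (Fin mU → ℝ)) →ₗ[ℝ] ℝ :=
  Sum.elim (fun i => LinearMap.proj i ∘ₗ LinearMap.fst ℝ _ _)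
    (fun i => LinearMap.proj i ∘ₗ LinearMap.fst ℝ _ _ ∘ₗ LinearMap.snd ℝ _ _)

theorem Omega_eq_polyhedron :
    D.Omega = polyhedron D.dualConstraint D.cC (dualCoord mG mA mU) := by
  ext v
  simp [Omega, polyhedron, dualConstraint, dualCoord, Pi.le_def, sub_eq_zero, eq_comm]

/-- The second-stage dual objective as a linear functional. -/
def dualObjLinear (x : Fin nx → ℝ) (ξ : Fin n → ℝ) :
    ((Fin mG → ℝ) × (Fin mA → ℝ) × (Fin mU → ℝ)) →ₗ[ℝ] ℝ where
  toFun := D.dualObj x ξ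
  map_add' v v' := by
    simp only [dualObj, Prod.fst_add, Prod.snd_add, dotProduct_add]
    ring
  map_smul' r v := by
    simp only [dualObj, Prod.smul_fst, Prod.smul_snd, dotProduct_smul, smul_eq_mul,
      RingHom.id_apply]
    ring

theorem dualObjLinear_apply (x : Fin nx → ℝ) (ξ : Fin n → ℝ)
    (v : (Fin mG → ℝ) × (Fin mA → ℝ) × (Fin mU → ℝ)) :
    D.dualObjLinear x ξ v = D.dualObj x ξ v := rfl

theorem finite_vert : D.vert.Finite := by
  rw [vert, Omega_eq_polyhedron]
  exact finite_extremePoints_polyhedron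

variable {D} {x : Fin nx → ℝ} {ξ : Fin n → ℝ}

/-- Weak duality for the second-stage linear program. -/
theorem dualObj_le_cost {y : Fin ny → ℝ} (hy : y ∈ D.dispatchSet x ξ)
    {v : (Fin mG → ℝ) × (Fin mA → ℝ) × (Fin mU → ℝ)} (hv : v ∈ D.Omega) :
    D.dualObj x ξ v ≤ D.cC ⬝ᵥ y := by
  obtain ⟨hG, hB, hU⟩ := hy
  obtain ⟨hc, h1, h2⟩ := hv
  have e1 : D.cC ⬝ᵥ y = (D.G *ᵥ y) ⬝ᵥ v.1 + (D.B *ᵥ y) ⬝ᵥ v.2.1 + (D.U *ᵥ y) ⬝ᵥ v.2.2 := by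
    rw [sub_eq_zero.mp hc, add_dotProduct, add_dotProduct]
    simp only [mulVec_transpose, ← dotProduct_mulVec, dotProduct_comm (_ *ᵥ y)]
  have e2 : D.U *ᵥ y = -(D.V *ᵥ ξ - D.W *ᵥ D.w) := by
    rw [← hU]
    abel
  have i1 : D.g ⬝ᵥ v.1 ≤ (D.G *ᵥ y) ⬝ᵥ v.1 := dotProduct_le_dotProduct_of_nonneg_right hG h1
  have hB' : -(D.A *ᵥ x - D.d) ≤ D.B *ᵥ y := fun i => by
    have := hB i
    simp only [Pi.add_apply, Pi.neg_apply, Pi.sub_apply] at this ⊢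
    linarith
  have i2 : -(D.A *ᵥ x - D.d) ⬝ᵥ v.2.1 ≤ (D.B *ᵥ y) ⬝ᵥ v.2.1 :=
    dotProduct_le_dotProduct_of_nonneg_right hB' h2
  rw [neg_dotProduct] at i2
  rw [e1, e2, neg_dotProduct, dualObj]
  linarith

theorem exists_vert_isGreatest (hrec : (D.dispatchSet x ξ).Nonempty) (hvert : D.vert.Nonempty) :
    ∃ v ∈ D.vert, ∀ v' ∈ D.Omega, D.dualObj x ξ v' ≤ D.dualObj x ξ v := by
  obtain ⟨y, hy⟩ := hrec
  obtain ⟨v, hv, hmax⟩ := Set.exists_max_image D.vert (D.dualObj x ξ) D.finite_vert hvert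
  refine ⟨v, hv, fun v' hv' => ?_⟩
  have hbdd : BddAbove (D.dualObjLinear x ξ '' D.Omega) :=
    ⟨D.cC ⬝ᵥ y, by
      rintro _ ⟨u, hu, rfl⟩
      exact dualObj_le_cost hy hu⟩
  rw [vert, Omega_eq_polyhedron] at hvert
  rw [Omega_eq_polyhedron] at hbdd hv'
  obtain ⟨u, hu, hle⟩ := exists_extremePoint_ge hvert (D.dualObjLinear x ξ) hbdd hv'
  rw [← Omega_eq_polyhedron] at hu
  exact le_trans hle (hmax u hu)

/-- Strong duality for the second-stage linear program: a value that bounds the dual is attained by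
a dispatch decision. A Farkas certificate for the contrary is, up to scaling, a dual feasible point
of larger value or a recession direction along which the dual is unbounded. -/
theorem exists_dispatch_cost_le (hne : D.Omega.Nonempty)
    {z : ℝ} (hz : ∀ v ∈ D.Omega, D.dualObj x ξ v ≤ z) :
    ∃ y ∈ D.dispatchSet x ξ, D.cC ⬝ᵥ y ≤ z := by
  by_contra hcon
  let r : Fin mU → ℝ := D.W *ᵥ D.w - D.V *ᵥ ξ
  obtain ⟨c, hc0, hcK, hck⟩ := exists_farkas_certificate
    (fromRows D.G (fromRows D.B (fromRows D.U (fromRows (-D.U) (replicateRow Unit (-D.cC))))))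
    (Sum.elim D.g (Sum.elim (D.d - D.A *ᵥ x) (Sum.elim r (Sum.elim (-r) fun _ => -z)))) (by
      rintro ⟨y, hy⟩
      simp only [fromRows_mulVec, Sum.elim_le_elim_iff] at hy
      obtain ⟨hG, hB, hU, hU', hcy⟩ := hy
      refine hcon ⟨y, ⟨hG, fun i => ?_, ?_⟩, ?_⟩
      · have := hB i
        simp only [Pi.add_apply, Pi.sub_apply] at this ⊢
        linarith
      · have h1 : D.U *ᵥ y = r := by
          refine le_antisymm ?_ hU
          rw [neg_mulVec] at hU'
          exact neg_le_neg_iff.mp hU'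
        rw [h1]
        simp [r]
      · have := hcy ()
        simp [mulVec, dotProduct] at this
        simpa [dotProduct] using this)
  let lam : Fin mG → ℝ := fun i => c (.inl i)
  let mu : Fin mA → ℝ := fun i => c (.inr (.inl i))
  let nu₁ : Fin mU → ℝ := fun i => c (.inr (.inr (.inl i)))
  let nu₂ : Fin mU → ℝ := fun i => c (.inr (.inr (.inr (.inl i))))
  let τ : ℝ := c (.inr (.inr (.inr (.inr ()))))
  have hce : c = Sum.elim lam (Sum.elim mu (Sum.elim nu₁ (Sum.elim nu₂ fun _ => τ))) := by
    ext (i | i | i | i | i) <;> rfl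
  have hτv : (fun _ : Unit => τ) ᵥ* replicateRow Unit (-D.cC) = -(τ • D.cC) := by
    ext j
    simp [vecMul, dotProduct]
  rw [hce] at hcK hck
  simp only [sumElim_vecMul_fromRows, hτv, vecMul_neg] at hcK
  simp only [sumElim_dotProduct_sumElim] at hck
  let v : (Fin mG → ℝ) × (Fin mA → ℝ) × (Fin mU → ℝ) := (lam, mu, nu₁ - nu₂)
  have hv1 : 0 ≤ v.1 := fun i => hc0 _
  have hv2 : 0 ≤ v.2.1 := fun i => hc0 _
  have hτ : 0 ≤ τ := hc0 _
  have hvc : D.dualConstraint v = τ • D.cC := by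
    change D.Gᵀ *ᵥ lam + D.Bᵀ *ᵥ mu + D.Uᵀ *ᵥ (nu₁ - nu₂) = τ • D.cC
    simp only [mulVec_transpose, sub_vecMul]
    rw [← sub_eq_zero, ← hcK]
    abel
  have hobj : τ * z < D.dualObjLinear x ξ v := by
    rw [dualObjLinear_apply, dualObj]
    have e1 : (fun _ : Unit => τ) ⬝ᵥ (fun _ => -z) = -(τ * z) := by simp [dotProduct]
    rw [e1, dotProduct_neg, dotProduct_comm lam, dotProduct_comm mu, ← neg_sub (D.A *ᵥ x),
      neg_dotProduct, dotProduct_comm nu₁, dotProduct_comm nu₂] at hck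
    have e2 : (D.V *ᵥ ξ - D.W *ᵥ D.w) ⬝ᵥ (nu₁ - nu₂) = -(r ⬝ᵥ nu₁ - r ⬝ᵥ nu₂) := by
      rw [← dotProduct_sub, ← neg_dotProduct, neg_sub]
    simp only [v]
    rw [e2]
    linarith
  rcases hτ.eq_or_lt with h0 | hpos
  · obtain ⟨v₀, hv₀⟩ := hne
    rw [← h0, zero_mul] at hobj
    rw [← h0, zero_smul] at hvc
    have hmem : v₀ + ((z - D.dualObjLinear x ξ v₀) / D.dualObjLinear x ξ v + 1) • v ∈ D.Omega := by
      have ht : 0 ≤ (z - D.dualObjLinear x ξ v₀) / D.dualObjLinear x ξ v + 1 :=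
        add_nonneg (div_nonneg (sub_nonneg.mpr (hz v₀ hv₀)) hobj.le) zero_le_one
      refine ⟨?_, add_nonneg hv₀.2.1 (smul_nonneg ht hv1), add_nonneg hv₀.2.2 (smul_nonneg ht hv2)⟩
      change D.cC - D.dualConstraint (v₀ + _ • v) = 0
      rw [map_add, map_smul, hvc, smul_zero, add_zero]
      exact hv₀.1
    have h1 := hz _ hmem
    rw [← dualObjLinear_apply, map_add, map_smul, smul_eq_mul, add_mul,
      div_mul_cancel₀ _ hobj.ne'] at h1
    linarith
  · have hmem : τ⁻¹ • v ∈ D.Omega := by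
      have ht : 0 ≤ τ⁻¹ := (inv_pos.mpr hpos).le
      refine ⟨?_, smul_nonneg ht hv1, smul_nonneg ht hv2⟩
      change D.cC - D.dualConstraint (τ⁻¹ • v) = 0
      rw [map_smul, hvc, smul_smul, inv_mul_cancel₀ hpos.ne', one_smul, sub_self]
    have h1 := hz _ hmem
    rw [← dualObjLinear_apply, map_smul, smul_eq_mul, inv_mul_le_iff₀ hpos] at h1
    linarith

/-- The second-stage value is attained, and equals the maxima of the dual objective over the dual
polyhedron and over its vertices. -/
theorem isLeast_Q_and_isGreatest_Q (hrec : (D.dispatchSet x ξ).Nonempty) (hvert : D.vert.Nonempty) :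
    IsLeast (D.dispatchCosts x ξ) (D.Q x ξ) ∧ IsGreatest (D.dualObj x ξ '' D.Omega) (D.Q x ξ) ∧
      IsGreatest (D.dualObj x ξ '' D.vert) (D.Q x ξ) := by
  obtain ⟨v, hv, hmax⟩ := exists_vert_isGreatest hrec hvert
  have hvΩ : v ∈ D.Omega := extremePoints_subset hv
  obtain ⟨y, hy, hle⟩ := exists_dispatch_cost_le ⟨v, hvΩ⟩ hmax
  have hyv : D.cC ⬝ᵥ y = D.dualObj x ξ v := le_antisymm hle (dualObj_le_cost hy hvΩ)
  have hleast : IsLeast (D.dispatchCosts x ξ) (D.dualObj x ξ v) := by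
    refine ⟨⟨y, hy, hyv.symm⟩, ?_⟩
    rintro _ ⟨y', hy', rfl⟩
    exact dualObj_le_cost hy' hvΩ
  have hQ : D.Q x ξ = D.dualObj x ξ v := hleast.csInf_eq
  rw [hQ]
  refine ⟨hleast, ⟨⟨v, hvΩ, rfl⟩, ?_⟩, ⟨⟨v, hv, rfl⟩, ?_⟩⟩
  · rintro _ ⟨u, hu, rfl⟩
    exact hmax u hu
  · rintro _ ⟨u, hu, rfl⟩
    exact hmax u (extremePoints_subset hu)

end UCData

namespace UCData

variable {nx ny n nw mF mG mA mU : ℕ} {D : UCData nx ny n nw mF mG mA mU} {x : Fin nx → ℝ}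

/-! ### Linear matrix inequalities -/

theorem borderedMatrix_eq (H : Matrix (Fin n) (Fin n) ℝ) (h : Fin n → ℝ) (h0 : ℝ)
    (v : (Fin mG → ℝ) × (Fin mA → ℝ) × (Fin mU → ℝ)) :
    D.borderedMatrix x H h h0 v = bordered H ((1 / 2 : ℝ) • (h + D.Vᵀ *ᵥ v.2.2))
      (h0 - D.g ⬝ᵥ v.1 + (D.A *ᵥ x - D.d) ⬝ᵥ v.2.1 - (D.W *ᵥ D.w) ⬝ᵥ v.2.2) := rfl

/-- The dual objective is affine in the uncertain parameter. -/
theorem dualObj_eq_affine (ξ : Fin n → ℝ) (v : (Fin mG → ℝ) × (Fin mA → ℝ) × (Fin mU → ℝ)) :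
    D.dualObj x ξ v = (D.g ⬝ᵥ v.1 - (D.A *ᵥ x - D.d) ⬝ᵥ v.2.1 + (D.W *ᵥ D.w) ⬝ᵥ v.2.2)
      + (-(D.Vᵀ *ᵥ v.2.2)) ⬝ᵥ ξ := by
  have : (D.V *ᵥ ξ) ⬝ᵥ v.2.2 = (D.Vᵀ *ᵥ v.2.2) ⬝ᵥ ξ := by
    rw [mulVec_transpose, ← dotProduct_mulVec, dotProduct_comm]
  rw [dualObj, sub_dotProduct (D.V *ᵥ ξ), this, neg_dotProduct]
  ring

theorem dualObj_le_quadFun_iff {H : Matrix (Fin n) (Fin n) ℝ} (hH : H.IsSymm) (h : Fin n → ℝ)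
    (h0 : ℝ) (v : (Fin mG → ℝ) × (Fin mA → ℝ) × (Fin mU → ℝ)) :
    (∀ ξ, D.dualObj x ξ v ≤ quadFun H h h0 ξ) ↔ (D.borderedMatrix x H h h0 v).PosSemidef := by
  rw [borderedMatrix_eq, ← quadratic_nonneg_iff_bordered_posSemidef hH]
  refine forall_congr' fun ξ => ?_
  rw [dualObj_eq_affine, quadFun, smul_dotProduct, add_dotProduct, neg_dotProduct, smul_eq_mul]
  constructor <;> intro <;> linarith

theorem semiInfFeasible_iff (hx : x ∈ D.firstStage)
    (hrec : ∀ ξ : Fin n → ℝ, (D.dispatchSet x ξ).Nonempty) (hvert : D.vert.Nonempty)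
    (H : Matrix (Fin n) (Fin n) ℝ) (h : Fin n → ℝ) (h0 : ℝ) :
    D.SemiInfFeasible x H h h0 ↔ D.MISDPFeasible x H h h0 := by
  constructor
  · rintro ⟨hH, hle⟩
    refine ⟨hx, fun v hv => (dualObj_le_quadFun_iff hH h h0 v).mp fun ξ => ?_⟩
    exact ((isLeast_Q_and_isGreatest_Q (hrec ξ) hvert).2.2.2 ⟨v, hv, rfl⟩).trans (hle ξ)
  · rintro ⟨-, hpsd⟩
    have hH : H.IsSymm := by
      obtain ⟨v, hv⟩ := hvert
      have := hpsd v hv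
      rw [borderedMatrix_eq, bordered_posSemidef_iff] at this
      exact this.1
    refine ⟨hH, fun ξ => ?_⟩
    obtain ⟨v, hv, hvQ⟩ := (isLeast_Q_and_isGreatest_Q (hrec ξ) hvert).2.2.1
    rw [← hvQ]
    exact (dualObj_le_quadFun_iff hH h h0 v).mpr (hpsd v hv) ξ

/-! ### The distributionally robust problem -/

/-- The second-stage value function is the maximum of finitely many affine functions, one for each
vertex of the dual polyhedron. -/
theorem isGreatest_affine_Q (hrec : ∀ ξ : Fin n → ℝ, (D.dispatchSet x ξ).Nonempty)
    (hvert : D.vert.Nonempty) (ξ : Fin n → ℝ) :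
    IsGreatest (Set.range fun v : D.vert =>
      (D.g ⬝ᵥ v.1.1 - (D.A *ᵥ x - D.d) ⬝ᵥ v.1.2.1 + (D.W *ᵥ D.w) ⬝ᵥ v.1.2.2)
        + (-(D.Vᵀ *ᵥ v.1.2.2)) ⬝ᵥ ξ) (D.Q x ξ) := by
  simp only [← dualObj_eq_affine]
  rw [← Set.image_eq_range]
  exact (isLeast_Q_and_isGreatest_Q (hrec ξ) hvert).2.2

theorem integrable_Q (hrec : ∀ ξ : Fin n → ℝ, (D.dispatchSet x ξ).Nonempty)
    (hvert : D.vert.Nonempty) {P : Measure (Fin n → ℝ)} (hP : P ∈ D.ambiguitySet) :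
    Integrable (D.Q x) P := by
  have := hP.1
  have := D.finite_vert.fintype
  have := hvert.to_subtype
  exact integrable_of_isGreatest_affine (isGreatest_affine_Q hrec hvert) fun j => (hP.2.1 j).1

theorem exists_isGreatest_isLeast (hSigma : D.Sigma.PosDef)
    (hrec : ∀ ξ : Fin n → ℝ, (D.dispatchSet x ξ).Nonempty) (hvert : D.vert.Nonempty) :
    ∃ z, IsGreatest (D.expectedCosts x) z ∧ IsLeast (D.semiInfCosts x) z := by
  have := D.finite_vert.fintype
  have := hvert.to_subtype
  obtain ⟨P, hP, H, h, h0, hH, hle, hobj⟩ :=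
    D.exists_law_and_majorant hSigma (isGreatest_affine_Q hrec hvert)
  have heq : ∫ ξ, D.Q x ξ ∂P = D.momentObj H h h0 :=
    le_antisymm (D.integral_le_momentObj hP (integrable_Q hrec hvert hP) hle) hobj
  refine ⟨∫ ξ, D.Q x ξ ∂P, ⟨⟨P, hP, rfl⟩, ?_⟩, ⟨⟨H, h, h0, ⟨hH, hle⟩, heq⟩, ?_⟩⟩
  · rintro _ ⟨P', hP', rfl⟩
    rw [heq]
    exact D.integral_le_momentObj hP' (integrable_Q hrec hvert hP') hle
  · rintro _ ⟨H', h', h0', ⟨-, hle'⟩, rfl⟩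
    exact D.integral_le_momentObj hP (integrable_Q hrec hvert hP) hle'

theorem drucObj_eq {z : ℝ} (hz : IsGreatest (D.expectedCosts x) z) :
    D.drucObj x = ((D.cI ⬝ᵥ x + z : ℝ) : EReal) := by
  obtain ⟨⟨P, hP, rfl⟩, hub⟩ := hz
  refine le_antisymm (iSup₂_le fun P' hP' => ?_) (le_iSup₂_of_le P hP le_rfl)
  exact EReal.coe_le_coe_iff.mpr (add_le_add_right (hub ⟨P', hP', rfl⟩) _)

variable (D) in
theorem finite_firstStage : D.firstStage.Finite := by
  refine (Set.Finite.pi' fun _ : Fin nx => Set.toFinite ({0, 1} : Set ℝ)).subset fun x hx j => ?_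
  simpa using hx.1 j

/-- Each feasible point of the semidefinite program bounds the robust objective at its first-stage
decision from above. -/
theorem drucObj_le_misdpObj {z : ℝ} (hz : IsGreatest (D.expectedCosts x) z)
    (hz' : IsLeast (D.semiInfCosts x) z) {H : Matrix (Fin n) (Fin n) ℝ} {h : Fin n → ℝ} {h0 : ℝ}
    (hf : D.SemiInfFeasible x H h h0) : D.drucObj x ≤ ((D.misdpObj x H h h0 : ℝ) : EReal) := by
  rw [drucObj_eq hz, EReal.coe_le_coe_iff, misdpObj]
  exact add_le_add_right (hz'.2 ⟨H, h, h0, hf, rfl⟩) _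

/-- The bound is attained. -/
theorem exists_misdpObj_eq_drucObj {z : ℝ} (hz : IsGreatest (D.expectedCosts x) z)
    (hz' : IsLeast (D.semiInfCosts x) z) :
    ∃ H h h0, D.SemiInfFeasible x H h h0 ∧ D.drucObj x = ((D.misdpObj x H h h0 : ℝ) : EReal) := by
  obtain ⟨H, h, h0, hf, rfl⟩ := hz'.1
  exact ⟨H, h, h0, hf, drucObj_eq hz⟩

end UCData

theorem mainTheorem2 {nx ny n nw mF mG mA mU : ℕ} (D : UCData nx ny n nw mF mG mA mU)
    (hSigma : D.Sigma.PosDef)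
    (hrec : ∀ x ∈ D.firstStage, ∀ ξ : Fin n → ℝ, (D.dispatchSet x ξ).Nonempty)
    (hvert : D.vert.Nonempty) :
    -- the vertex set is finite, so the semidefinite program has finitely many constraints
    D.vert.Finite ∧
    (∀ x ∈ D.firstStage,
      -- `Q` is an attained minimum, and the attained maximum of the dual over `Ω` and over `vert Ω`
      (∀ ξ : Fin n → ℝ,
        IsLeast (D.dispatchCosts x ξ) (D.Q x ξ) ∧
        IsGreatest (D.dualObj x ξ '' D.Omega) (D.Q x ξ) ∧
        IsGreatest (D.dualObj x ξ '' D.vert) (D.Q x ξ)) ∧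
      -- the expectations of `Q` exist
      (∀ P ∈ D.ambiguitySet, Integrable (D.Q x) P) ∧
      -- strong duality for the moment problem, both optimal values being attained
      (∃ z : ℝ, IsGreatest (D.expectedCosts x) z ∧ IsLeast (D.semiInfCosts x) z) ∧
      -- each quadratic inequality on the whole space is a linear matrix inequality
      (∀ v ∈ D.vert, ∀ (H : Matrix (Fin n) (Fin n) ℝ) (h : Fin n → ℝ) (h0 : ℝ), H.IsSymm →
        ((∀ ξ : Fin n → ℝ, D.dualObj x ξ v ≤ UCData.quadFun H h h0 ξ) ↔
          (D.borderedMatrix x H h h0 v).PosSemidef)) ∧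
      -- the semi-infinite constraint is the finite system of linear matrix inequalities
      (∀ (H : Matrix (Fin n) (Fin n) ℝ) (h : Fin n → ℝ) (h0 : ℝ),
        D.SemiInfFeasible x H h h0 ↔ D.MISDPFeasible x H h h0)) ∧
    -- the two problems have the same optimal value
    D.drucValue = D.misdpValue ∧
    -- and the same optimal first-stage decisions
    (∀ x : Fin nx → ℝ, D.IsDRUCOptimal x ↔
      ∃ (H : Matrix (Fin n) (Fin n) ℝ) (h : Fin n → ℝ) (h0 : ℝ), D.IsMISDPOptimal x H h h0) ∧
    -- which exist as soon as a feasible first-stage decision exists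
    (D.firstStage.Nonempty → ∃ x : Fin nx → ℝ, D.IsDRUCOptimal x) := by
  have hdual : ∀ x ∈ D.firstStage,
      ∃ z, IsGreatest (D.expectedCosts x) z ∧ IsLeast (D.semiInfCosts x) z :=
    fun x hx => UCData.exists_isGreatest_isLeast hSigma (hrec x hx) hvert
  have hfeas : ∀ x ∈ D.firstStage, ∀ H h h0,
      D.SemiInfFeasible x H h h0 ↔ D.MISDPFeasible x H h h0 :=
    fun x hx => UCData.semiInfFeasible_iff hx (hrec x hx) hvert
  have hupper : ∀ x H h h0, D.MISDPFeasible x H h h0 →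
      D.drucObj x ≤ ((D.misdpObj x H h h0 : ℝ) : EReal) := by
    intro x H h h0 hf
    obtain ⟨z, hz, hz'⟩ := hdual x hf.1
    exact UCData.drucObj_le_misdpObj hz hz' ((hfeas x hf.1 H h h0).mpr hf)
  have hattain : ∀ x ∈ D.firstStage, ∃ H h h0, D.MISDPFeasible x H h h0 ∧
      D.drucObj x = ((D.misdpObj x H h h0 : ℝ) : EReal) := by
    intro x hx
    obtain ⟨z, hz, hz'⟩ := hdual x hx
    obtain ⟨H, h, h0, hf, he⟩ := UCData.exists_misdpObj_eq_drucObj hz hz'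
    exact ⟨H, h, h0, (hfeas x hx H h h0).mp hf, he⟩
  refine ⟨D.finite_vert, fun x hx => ⟨fun ξ =>
      UCData.isLeast_Q_and_isGreatest_Q (hrec x hx ξ) hvert,
    fun P hP => UCData.integrable_Q (hrec x hx) hvert hP, hdual x hx,
    fun v _ H h h0 hH => UCData.dualObj_le_quadFun_iff hH h h0 v, hfeas x hx⟩, ?_, ?_, ?_⟩
  · refine le_antisymm ?_ ?_
    · refine le_iInf fun x => le_iInf fun H => le_iInf fun h => le_iInf fun h0 => le_iInf fun hf => ?_
      exact (iInf₂_le x hf.1).trans (hupper x H h h0 hf)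
    · refine le_iInf₂ fun x hx => ?_
      obtain ⟨H, h, h0, hf, he⟩ := hattain x hx
      rw [he]
      exact iInf_le_of_le x (iInf_le_of_le H (iInf_le_of_le h (iInf_le_of_le h0
        (iInf_le_of_le hf le_rfl))))
  · intro x
    constructor
    · rintro ⟨hx, hopt⟩
      obtain ⟨H, h, h0, hf, he⟩ := hattain x hx
      refine ⟨H, h, h0, hf, fun x' H' h' h0' hf' => ?_⟩
      rw [← EReal.coe_le_coe_iff, ← he]
      exact (hopt x' hf'.1).trans (hupper x' H' h' h0' hf')
    · rintro ⟨H, h, h0, hf, hopt⟩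
      refine ⟨hf.1, fun x' hx' => ?_⟩
      obtain ⟨H', h', h0', hf', he'⟩ := hattain x' hx'
      rw [he']
      exact (hupper x H h h0 hf).trans (EReal.coe_le_coe_iff.mpr (hopt x' H' h' h0' hf'))
  · intro hne
    obtain ⟨x, hx, hmin⟩ := Set.exists_min_image D.firstStage D.drucObj D.finite_firstStage hne
    exact ⟨x, hx, hmin⟩
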